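/- Let $w\in L^3(\mathbb R,dx)$, $w\ge 0$ almost everywhere, be such that the measure $d\mu(x)=w(x)\,dx$ is compactly supported. For a real- or complex-valued function $f\in L^2(\mu)$ (all $L^p(\mu)$ spaces being over the same scalar field) put $$L_\mu[f](x)=\mathrm{p.v.}\!\int_{\mathbb R}\frac{f(x)-f(y)}{x-y}\,d\mu(y)=\lim_{\varepsilon\to0^+}\int_{|x-y|>\varepsilon}\frac{f(x)-f(y)}{x-y}\,d\mu(y).$$ Then: 1. for every $f\in L^2(\mu)$ the limit $L_\mu[f](x)$ exists for $\mu$-almost every $x$ and $L_\mu[f]\in L^1(\mu)$, and $L_\mu$ is a bounded linear operator from $L^2(\mu)$ to $L^1(\mu)$; 2. for every $f\in L^\infty(\mu)$ one has $L_\mu[f]\in L^2(\mu)$, and $L_\mu$ is a bounded linear operator from $L^\infty(\mu)$ to $L^2(\mu)$; 3. $L_\mu$, with domain $\{f\in L^2(\mu): L_\mu[f]\in L^2(\mu)\}$, is a (possibly unbounded) densely defined closed linear operator on $L^2(\mu)$. -/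

import Mathlib

open MeasureTheory Filter Topology
open scoped ENNReal

/-- The truncated difference-quotient integral
`∫_{|x - y| > ε} (f x - f y) / (x - y) dμ(y)`. For a finite measure `μ`, `f ∈ L¹(μ)` and `ε > 0`
the integrand is `μ`-integrable for every `x`, so no junk value occurs. -/
noncomputable def truncDiffQuotient {𝕜 : Type*} [RCLike 𝕜] (μ : Measure ℝ) (ε : ℝ)
    (f : ℝ → 𝕜) (x : ℝ) : 𝕜 :=
  ∫ y in {y : ℝ | ε < |x - y|}, (f x - f y) / ((x - y : ℝ) : 𝕜) ∂μ

/-- `L_μ[f] = g`: for `μ`-almost every `x`, the integral `∫ (f x - f y) / (x - y) dμ(y)`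
converges as a principal value (symmetric truncation around the diagonal `y = x`) and its value
is `g x`. -/
def IsDiffQuotientOf {𝕜 : Type*} [RCLike 𝕜] (μ : Measure ℝ) (f g : ℝ → 𝕜) : Prop :=
  ∀ᵐ x ∂μ, Tendsto (fun ε : ℝ => truncDiffQuotient μ ε f x) (𝓝[>] (0 : ℝ)) (𝓝 (g x))

/-!
The difference quotient transform is `L_μ f = f · H[μ] - H[f μ]`, where
`H[σ] x = p.v. ∫ dσ(y) / (x - y)` is the Hilbert transform. Thus everything reduces to the almost
everywhere existence of `H[f μ]` for `f ∈ L²(μ)`, and to bounds `L²(μ) → L¹(μ)` and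
`L∞(μ) → L²(μ)` for `f ↦ H[f μ]`.

*Bounds.* With `1 / u` regularized to the conjugate Poisson kernel `k(u) = u / (u² + δ²)`, let
`Q σ = ∫ k(· - y) dσ(y)`, and let `P σ` be the corresponding integral of the Poisson kernel.
Writing `∫ (Q σ)² dσ` as a triple integral and symmetrizing, the identity
`1 / (ab) + 1 / (bc) + 1 / (ca) = 0` for `a + b + c = 0` leaves only an error term, whence
`∫ (Q σ)² dσ ≤ ½ ∫ (P σ)² dσ` for every finite measure `σ` (`integral_conj_sq_le`). Comparing
`σ + ν` with `ν` gives `∫ (Q σ)² dν ≤ 9 ∫ (P ν)² dν` whenever `σ ≤ ν`, which is the `L∞ → L²` bound; the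
kernel being odd, the `L² → L¹` bound is dual to it (`integral_abs_conj_le`). For `ν = w dx` the
arithmetic-geometric mean inequality and Tonelli bound `∫ (P ν)² dν` by a multiple of `∫ w³`,
uniformly in `δ` (`exists_integral_poisson_sq_le`).

*Existence.* The duality bound applied with `ν = μ + dx` on an interval containing the support shows
that the functions `Q (f μ)` are bounded in `L¹(dx)` there, uniformly in `δ`. They are the
derivatives of smooth approximations to the logarithmic potential `Φ x = ∫ log |x - y| f(y) dμ(y)`,
so `Φ` has bounded variation and is differentiable almost everywhere. At a Lebesgue point of the
density of `f μ` where `Φ` is differentiable, the truncated integrals, the functions `Q (f μ)` and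
the averaged symmetric difference quotients of `Φ` have the same limit: the differences of their
kernels are odd and dominated by Poisson kernels (`ae_exists_tendsto_truncKer`). The bounds pass to
the limit by Fatou's lemma.

*The closed operator.* The graph of `L_μ` on `L²(μ)` is the kernel of the continuous map
`(f, g) ↦ L_μ f - g` into `L¹(μ)`, and its domain contains all bounded functions.
-/


/-! ### Poisson kernels and symmetrization -/

/-- The Poisson kernel `δ / (u² + δ²)` of the upper half-plane, without the factor `1 / π`. -/
noncomputable def poissonKer (δ u : ℝ) : ℝ := δ / (u ^ 2 + δ ^ 2)

/-- The conjugate Poisson kernel `u / (u² + δ²)`, a bounded regularization of `1 / u`. -/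
noncomputable def conjKer (δ u : ℝ) : ℝ := u / (u ^ 2 + δ ^ 2)

lemma measurable_poissonKer (δ : ℝ) : Measurable (poissonKer δ) := by
  unfold poissonKer; fun_prop

lemma measurable_conjKer (δ : ℝ) : Measurable (conjKer δ) := by
  unfold conjKer; fun_prop

lemma poissonKer_nonneg {δ : ℝ} (hδ : 0 < δ) (u : ℝ) : 0 ≤ poissonKer δ u := by
  unfold poissonKer; positivity

lemma poissonKer_le {δ : ℝ} (hδ : 0 < δ) (u : ℝ) : poissonKer δ u ≤ 1 / δ := by
  unfold poissonKer
  rw [div_le_div_iff₀ (by positivity) hδ]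
  nlinarith [sq_nonneg u]

lemma conjKer_neg (δ u : ℝ) : conjKer δ (-u) = -conjKer δ u := by
  simp [conjKer, neg_div]

lemma abs_conjKer_le {δ : ℝ} (hδ : 0 < δ) (u : ℝ) : |conjKer δ u| ≤ 1 / δ := by
  unfold conjKer
  rw [abs_div, abs_of_pos (show 0 < u ^ 2 + δ ^ 2 by positivity),
    div_le_div_iff₀ (by positivity) hδ, ← sq_abs u]
  nlinarith [sq_nonneg (|u| - δ), abs_nonneg u]

/-- For `a + b + c = 0` the products of values of `1 / u` cancel cyclically; after regularization
the error is controlled by Poisson kernels. -/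
lemma conjKer_cyclic_le {δ : ℝ} (hδ : 0 < δ) (x y z : ℝ) :
    conjKer δ (x - y) * conjKer δ (x - z) + conjKer δ (y - z) * conjKer δ (y - x)
      + conjKer δ (z - x) * conjKer δ (z - y)
    ≤ (1 / 2) * (poissonKer δ (x - y) * poissonKer δ (x - z)
      + poissonKer δ (y - z) * poissonKer δ (y - x)
      + poissonKer δ (z - x) * poissonKer δ (z - y)) := by
  have h1 : 0 < (x - y) ^ 2 + δ ^ 2 := by positivity
  have h2 : 0 < (y - z) ^ 2 + δ ^ 2 := by positivity
  have h3 : 0 < (x - z) ^ 2 + δ ^ 2 := by positivity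
  have e1 : (y - x) ^ 2 = (x - y) ^ 2 := by ring
  have e2 : (z - y) ^ 2 = (y - z) ^ 2 := by ring
  have e3 : (z - x) ^ 2 = (x - z) ^ 2 := by ring
  rw [← sub_nonneg]
  have key : (1 / 2) * (poissonKer δ (x - y) * poissonKer δ (x - z)
      + poissonKer δ (y - z) * poissonKer δ (y - x)
      + poissonKer δ (z - x) * poissonKer δ (z - y)) -
      (conjKer δ (x - y) * conjKer δ (x - z) + conjKer δ (y - z) * conjKer δ (y - x)
      + conjKer δ (z - x) * conjKer δ (z - y)) =
      (3 / 2) * δ ^ 4 /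
        (((x - y) ^ 2 + δ ^ 2) * ((y - z) ^ 2 + δ ^ 2) * ((x - z) ^ 2 + δ ^ 2)) := by
    unfold poissonKer conjKer
    rw [e1, e2, e3]
    field_simp
    ring
  rw [key]
  positivity

lemma integrable_conjKer {δ : ℝ} (hδ : 0 < δ) (σ : Measure ℝ) [IsFiniteMeasure σ] (x : ℝ) :
    Integrable (fun y => conjKer δ (x - y)) σ :=
  Integrable.of_bound
    ((measurable_conjKer δ).comp (measurable_id.const_sub x)).aestronglyMeasurable (1 / δ)
    (ae_of_all _ fun _ => abs_conjKer_le hδ _)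

lemma integrable_poissonKer {δ : ℝ} (hδ : 0 < δ) (σ : Measure ℝ) [IsFiniteMeasure σ] (x : ℝ) :
    Integrable (fun y => poissonKer δ (x - y)) σ :=
  Integrable.of_bound
    ((measurable_poissonKer δ).comp (measurable_id.const_sub x)).aestronglyMeasurable (1 / δ)
    (ae_of_all _ fun y => by
      rw [Real.norm_eq_abs, abs_of_nonneg (poissonKer_nonneg hδ _)]
      exact poissonKer_le hδ _)

/-- The integral of a function of three variables is invariant under their cyclic permutation. -/
lemma integral_prod_prod_cyclic (σ : Measure ℝ) [IsFiniteMeasure σ] (F : ℝ × ℝ × ℝ → ℝ) :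
    ∫ p, F (p.2.1, p.2.2, p.1) ∂(σ.prod (σ.prod σ)) = ∫ p, F p ∂(σ.prod (σ.prod σ)) := by
  have h1 : MeasurePreserving (fun p : ℝ × ℝ × ℝ => (p.2.1, p.2.2, p.1))
      (σ.prod (σ.prod σ)) (σ.prod (σ.prod σ)) :=
    (measurePreserving_prodAssoc σ σ σ).comp Measure.measurePreserving_swap
  have h2 : MeasurableEmbedding (fun p : ℝ × ℝ × ℝ => (p.2.1, p.2.2, p.1)) :=
    (MeasurableEquiv.prodAssoc.measurableEmbedding).comp
      (MeasurableEquiv.prodComm (α := ℝ) (β := ℝ × ℝ)).measurableEmbedding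
  exact h1.integral_comp h2 F

/-- The integral of a squared kernel transform as a triple integral. -/
lemma integral_sq_eq_integral_prod (σ : Measure ℝ) [IsFiniteMeasure σ] {κ : ℝ → ℝ}
    (hκ : Measurable κ) {C : ℝ} (hC : ∀ u, |κ u| ≤ C) :
    Integrable (fun p : ℝ × ℝ × ℝ => κ (p.1 - p.2.1) * κ (p.1 - p.2.2)) (σ.prod (σ.prod σ)) ∧
    ∫ x, (∫ y, κ (x - y) ∂σ) ^ 2 ∂σ =
      ∫ p : ℝ × ℝ × ℝ, κ (p.1 - p.2.1) * κ (p.1 - p.2.2) ∂(σ.prod (σ.prod σ)) := by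
  have hint : Integrable (fun p : ℝ × ℝ × ℝ => κ (p.1 - p.2.1) * κ (p.1 - p.2.2))
      (σ.prod (σ.prod σ)) := by
    refine Integrable.of_bound (by fun_prop) (C * C) (ae_of_all _ fun p => ?_)
    rw [Real.norm_eq_abs, abs_mul]
    exact mul_le_mul (hC _) (hC _) (abs_nonneg _) ((abs_nonneg _).trans (hC 0))
  refine ⟨hint, ?_⟩
  rw [integral_prod _ hint]
  congr 1
  ext x
  rw [integral_prod_mul (fun y => κ (x - y)) (fun z => κ (x - z)), sq]

/-- Symmetrizing the triple integral, the conjugate Poisson integral of a finite measure is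
controlled, in `L²` of the same measure, by its Poisson integral. -/
lemma integral_conj_sq_le (σ : Measure ℝ) [IsFiniteMeasure σ] {δ : ℝ} (hδ : 0 < δ) :
    ∫ x, (∫ y, conjKer δ (x - y) ∂σ) ^ 2 ∂σ
      ≤ (1 / 2) * ∫ x, (∫ y, poissonKer δ (x - y) ∂σ) ^ 2 ∂σ := by
  obtain ⟨i1, e1⟩ := integral_sq_eq_integral_prod σ (measurable_conjKer δ) (abs_conjKer_le hδ)
  obtain ⟨i2, e2⟩ := integral_sq_eq_integral_prod σ (measurable_poissonKer δ) (C := 1 / δ)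
    (fun u => by rw [abs_of_nonneg (poissonKer_nonneg hδ _)]; exact poissonKer_le hδ _)
  rw [e1, e2]
  set ρ := σ.prod (σ.prod σ)
  set τ : ℝ × ℝ × ℝ → ℝ × ℝ × ℝ := fun p => (p.2.1, p.2.2, p.1) with hτ
  have mp : MeasurePreserving τ ρ ρ :=
    (measurePreserving_prodAssoc σ σ σ).comp Measure.measurePreserving_swap
  set F : ℝ × ℝ × ℝ → ℝ := fun p => conjKer δ (p.1 - p.2.1) * conjKer δ (p.1 - p.2.2) with hF
  set G : ℝ × ℝ × ℝ → ℝ :=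
    fun p => poissonKer δ (p.1 - p.2.1) * poissonKer δ (p.1 - p.2.2) with hG
  have cyc : ∀ H : ℝ × ℝ × ℝ → ℝ, Integrable H ρ →
      ∫ p, (H p + H (τ p) + H (τ (τ p))) ∂ρ = 3 * ∫ p, H p ∂ρ := by
    intro H hH
    have h1 : Integrable (fun p => H (τ p)) ρ := mp.integrable_comp_of_integrable hH
    have h2 : Integrable (fun p => H (τ (τ p))) ρ := mp.integrable_comp_of_integrable h1
    have s1 : ∫ p, (H p + H (τ p) + H (τ (τ p))) ∂ρ
        = ∫ p, (H p + H (τ p)) ∂ρ + ∫ p, H (τ (τ p)) ∂ρ := integral_add (hH.add h1) h2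
    rw [s1, integral_add hH h1]
    have t1 : ∫ p, H (τ p) ∂ρ = ∫ p, H p ∂ρ := integral_prod_prod_cyclic σ H
    have t2 : ∫ p, H (τ (τ p)) ∂ρ = ∫ p, H (τ p) ∂ρ :=
      integral_prod_prod_cyclic σ (fun p => H (τ p))
    rw [t2, t1]; ring
  have hle : ∫ p, (F p + F (τ p) + F (τ (τ p))) ∂ρ
      ≤ ∫ p, (1 / 2) * (G p + G (τ p) + G (τ (τ p))) ∂ρ := by
    have hi : ∀ H : ℝ × ℝ × ℝ → ℝ, Integrable H ρ →
        Integrable (fun p => H p + H (τ p) + H (τ (τ p))) ρ := fun H hH =>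
      (hH.add (mp.integrable_comp_of_integrable hH)).add
        ((mp.comp mp).integrable_comp_of_integrable hH)
    refine integral_mono (hi F i1) ((hi G i2).const_mul _) fun p => ?_
    exact conjKer_cyclic_le hδ p.1 p.2.1 p.2.2
  rw [integral_const_mul, cyc F i1, cyc G i2] at hle
  linarith

lemma abs_integral_le_of_bound (σ : Measure ℝ) [IsFiniteMeasure σ] {κ : ℝ → ℝ} {C : ℝ}
    (hC : ∀ u, |κ u| ≤ C) (x : ℝ) : |∫ y, κ (x - y) ∂σ| ≤ C * σ.real Set.univ := by
  have := norm_integral_le_of_norm_le_const (μ := σ) (f := fun y => κ (x - y)) (C := C)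
    (ae_of_all _ fun y => hC _)
  simpa using this

/-- Squares of transforms by bounded kernels are integrable against finite measures. -/
lemma integrable_sq_integral (σ ν : Measure ℝ) [IsFiniteMeasure σ] [IsFiniteMeasure ν] {κ : ℝ → ℝ}
    (hκ : Measurable κ) {C : ℝ} (hC : ∀ u, |κ u| ≤ C) :
    Integrable (fun x => (∫ y, κ (x - y) ∂σ) ^ 2) ν := by
  have hm : StronglyMeasurable (fun x => ∫ y, κ (x - y) ∂σ) :=
    StronglyMeasurable.integral_prod_right (f := fun x y => κ (x - y))
      (by apply Measurable.stronglyMeasurable; fun_prop)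
  refine Integrable.of_bound (hm.pow 2).aestronglyMeasurable ((C * σ.real Set.univ) ^ 2)
    (ae_of_all _ fun x => ?_)
  rw [norm_pow]
  exact pow_le_pow_left₀ (norm_nonneg _) (abs_integral_le_of_bound σ hC x) 2

/-- The estimate of `integral_conj_sq_le` for a measure dominated by `ν`, measured in `L²(ν)`:
it is obtained from the measures `σ + ν` and `ν`. -/
lemma integral_conj_sq_le_of_le {σ ν : Measure ℝ} [IsFiniteMeasure σ] [IsFiniteMeasure ν]
    (h : σ ≤ ν) {δ : ℝ} (hδ : 0 < δ) :
    ∫ x, (∫ y, conjKer δ (x - y) ∂σ) ^ 2 ∂ν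
      ≤ 9 * ∫ x, (∫ y, poissonKer δ (x - y) ∂ν) ^ 2 ∂ν := by
  have hPb : ∀ u, |poissonKer δ u| ≤ 1 / δ := fun u => by
    rw [abs_of_nonneg (poissonKer_nonneg hδ _)]; exact poissonKer_le hδ _
  have mP := measurable_poissonKer δ
  have mk := measurable_conjKer δ
  have kb := abs_conjKer_le hδ
  have a1 := integral_conj_sq_le (σ + ν) hδ
  have a2 := integral_conj_sq_le ν hδ
  set A := ∫ x, (∫ y, poissonKer δ (x - y) ∂ν) ^ 2 ∂ν with hA
  have b1 : ∫ x, (∫ y, poissonKer δ (x - y) ∂(σ + ν)) ^ 2 ∂(σ + ν) ≤ 8 * A := by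
    have hpt : ∀ x, (∫ y, poissonKer δ (x - y) ∂(σ + ν)) ^ 2
        ≤ 4 * (∫ y, poissonKer δ (x - y) ∂ν) ^ 2 := by
      intro x
      rw [integral_add_measure (integrable_poissonKer hδ σ x) (integrable_poissonKer hδ ν x)]
      have h0 : 0 ≤ ∫ y, poissonKer δ (x - y) ∂σ :=
        integral_nonneg fun y => poissonKer_nonneg hδ _
      have h1 : ∫ y, poissonKer δ (x - y) ∂σ ≤ ∫ y, poissonKer δ (x - y) ∂ν :=
        integral_mono_measure h (ae_of_all _ fun y => poissonKer_nonneg hδ _)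
          (integrable_poissonKer hδ ν x)
      nlinarith
    calc _ ≤ ∫ x, 4 * (∫ y, poissonKer δ (x - y) ∂ν) ^ 2 ∂(σ + ν) :=
          integral_mono (integrable_sq_integral _ _ mP hPb)
            ((integrable_sq_integral _ _ mP hPb).const_mul 4) hpt
      _ = 4 * (∫ x, (∫ y, poissonKer δ (x - y) ∂ν) ^ 2 ∂σ + A) := by
          rw [integral_const_mul, integral_add_measure (integrable_sq_integral _ _ mP hPb)
            (integrable_sq_integral _ _ mP hPb)]
      _ ≤ 4 * (A + A) := by
          gcongr
          exact integral_mono_measure h (ae_of_all _ fun x => sq_nonneg _)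
            (integrable_sq_integral _ _ mP hPb)
      _ = 8 * A := by ring
  have b2 : ∫ x, (∫ y, conjKer δ (x - y) ∂(σ + ν)) ^ 2 ∂ν
      ≤ ∫ x, (∫ y, conjKer δ (x - y) ∂(σ + ν)) ^ 2 ∂(σ + ν) :=
    integral_mono_measure (Measure.le_add_left le_rfl) (ae_of_all _ fun x => sq_nonneg _)
      (integrable_sq_integral _ _ mk kb)
  -- the transform of `σ` is that of `σ + ν` minus that of `ν`
  have b3 : ∫ x, (∫ y, conjKer δ (x - y) ∂σ) ^ 2 ∂ν
      ≤ ∫ x, (2 * (∫ y, conjKer δ (x - y) ∂(σ + ν)) ^ 2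
        + 2 * (∫ y, conjKer δ (x - y) ∂ν) ^ 2) ∂ν := by
    refine integral_mono (integrable_sq_integral _ _ mk kb)
      (((integrable_sq_integral _ _ mk kb).const_mul 2).add
        ((integrable_sq_integral _ _ mk kb).const_mul 2)) fun x => ?_
    simp only
    rw [integral_add_measure (integrable_conjKer hδ σ x) (integrable_conjKer hδ ν x)]
    nlinarith [sq_nonneg (∫ y, conjKer δ (x - y) ∂σ + 2 * ∫ y, conjKer δ (x - y) ∂ν)]
  rw [integral_add ((integrable_sq_integral _ _ mk kb).const_mul 2)
    ((integrable_sq_integral _ _ mk kb).const_mul 2), integral_const_mul, integral_const_mul] at b3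
  linarith

/-- Duality: since the conjugate Poisson kernel is odd, the `L∞ → L²` bound
`integral_conj_sq_le_of_le` gives an `L² → L¹` bound. -/
lemma integral_abs_conj_le {μ σ ν : Measure ℝ} [IsFiniteMeasure μ] [IsFiniteMeasure σ]
    [IsFiniteMeasure ν] (hμ : μ ≤ ν) (hσ : σ ≤ ν) {δ A : ℝ} (hδ : 0 < δ)
    (hA : ∫ x, (∫ y, poissonKer δ (x - y) ∂ν) ^ 2 ∂ν ≤ A) {f : ℝ → ℝ} (hf : MemLp f 2 μ) :
    ∫ x, |∫ y, conjKer δ (x - y) * f y ∂μ| ∂σ ≤ 6 * √A * √(∫ y, f y ^ 2 ∂μ) := by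
  have mk := measurable_conjKer δ
  have kb := abs_conjKer_le hδ
  have hf1 : Integrable f μ := hf.integrable (by norm_num)
  have hprod : ∀ τ : Measure ℝ, [IsFiniteMeasure τ] →
      Integrable (fun p : ℝ × ℝ => conjKer δ (p.1 - p.2) * f p.2) (τ.prod μ) := by
    intro τ _
    exact (hf1.comp_snd τ).bdd_mul (c := 1 / δ)
      (mk.comp (measurable_fst.sub measurable_snd)).aestronglyMeasurable (ae_of_all _ fun p => kb _)
  -- the bound for the part of `σ` on which the transform has constant sign
  have half : ∀ τ : Measure ℝ, [IsFiniteMeasure τ] → τ ≤ ν →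
      |∫ x, ∫ y, conjKer δ (x - y) * f y ∂μ ∂τ| ≤ 3 * √A * √(∫ y, f y ^ 2 ∂μ) := by
    intro τ _ hτ
    set q : ℝ → ℝ := fun y => ∫ x, conjKer δ (y - x) ∂τ with hq
    have e : ∫ x, ∫ y, conjKer δ (x - y) * f y ∂μ ∂τ = -∫ y, q y * f y ∂μ := by
      rw [integral_integral_swap (hprod τ), ← integral_neg]
      congr 1
      ext y
      rw [integral_mul_const, ← neg_mul, hq, ← integral_neg]
      congr 2
      ext x
      rw [← conjKer_neg, neg_sub]
    have qm : MemLp q 2 μ := by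
      have hm : StronglyMeasurable q :=
        StronglyMeasurable.integral_prod_right (f := fun x y => conjKer δ (x - y))
          (by apply Measurable.stronglyMeasurable; fun_prop)
      exact (memLp_two_iff_integrable_sq hm.aestronglyMeasurable).2
        (integrable_sq_integral τ μ mk kb)
    have q2 : ∫ y, q y ^ 2 ∂μ ≤ 9 * A := by
      calc ∫ y, q y ^ 2 ∂μ ≤ ∫ y, q y ^ 2 ∂ν :=
            integral_mono_measure hμ (ae_of_all _ fun x => sq_nonneg _)
              (integrable_sq_integral τ ν mk kb)
        _ ≤ 9 * ∫ x, (∫ y, poissonKer δ (x - y) ∂ν) ^ 2 ∂ν := integral_conj_sq_le_of_le hτ hδ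
        _ ≤ 9 * A := by gcongr
    rw [e, abs_neg]
    have cs := integral_mul_norm_le_Lp_mul_Lq (μ := μ) (f := q) (g := f)
      Real.HolderConjugate.two_two (by simpa using qm) (by simpa using hf)
    calc |∫ y, q y * f y ∂μ| ≤ ∫ y, ‖q y‖ * ‖f y‖ ∂μ := by
          simpa only [Real.norm_eq_abs, abs_mul] using
            norm_integral_le_integral_norm (μ := μ) (fun y => q y * f y)
      _ ≤ √(∫ y, q y ^ 2 ∂μ) * √(∫ y, f y ^ 2 ∂μ) := by
          simpa [Real.sqrt_eq_rpow] using cs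
      _ ≤ √(9 * A) * √(∫ y, f y ^ 2 ∂μ) := by gcongr
      _ = 3 * √A * √(∫ y, f y ^ 2 ∂μ) := by
          rw [show (9 : ℝ) * A = 3 ^ 2 * A by norm_num, Real.sqrt_mul (by norm_num),
            Real.sqrt_sq (by norm_num)]
  set Q : ℝ → ℝ := fun x => ∫ y, conjKer δ (x - y) * f y ∂μ with hQ
  have hQm : Integrable Q σ := (hprod σ).integral_prod_left
  -- a measurable version of `Q`, to have a measurable set of positivity
  set E : Set ℝ := {x | 0 ≤ hQm.1.mk Q x} with hE
  have hEm : MeasurableSet E := measurableSet_le measurable_const hQm.1.measurable_mk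
  have hmk : Q =ᵐ[σ] hQm.1.mk Q := hQm.1.ae_eq_mk
  have e1 : ∫ x in E, |Q x| ∂σ = ∫ x in E, Q x ∂σ := by
    refine setIntegral_congr_ae hEm ?_
    filter_upwards [hmk] with x hx hxE
    rw [abs_of_nonneg]
    rw [hx]; exact hxE
  have e2 : ∫ x in Eᶜ, |Q x| ∂σ = -∫ x in Eᶜ, Q x ∂σ := by
    rw [← integral_neg]
    refine setIntegral_congr_ae hEm.compl ?_
    filter_upwards [hmk] with x hx hxE
    rw [abs_of_nonpos]
    rw [hx]; exact (not_le.1 (show ¬ 0 ≤ hQm.1.mk Q x from hxE)).le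
  rw [← integral_add_compl hEm hQm.abs, e1, e2]
  have h1 := half (σ.restrict E) (Measure.restrict_le_self.trans hσ)
  have h2 := half (σ.restrict Eᶜ) (Measure.restrict_le_self.trans hσ)
  have := le_abs_self (∫ x in E, Q x ∂σ)
  have := neg_le_abs (∫ x in Eᶜ, Q x ∂σ)
  linarith

/-! ### Poisson integrals of measures with density in `L³` -/

lemma poissonKer_eq_scaled {δ : ℝ} (hδ : 0 < δ) (u : ℝ) :
    poissonKer δ u = δ⁻¹ * (1 + (u / δ) ^ 2)⁻¹ := by
  unfold poissonKer
  field_simp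
  ring

lemma integrable_poissonKer_volume {δ : ℝ} (hδ : 0 < δ) : Integrable (poissonKer δ) := by
  have h := (integrable_inv_one_add_sq.comp_div hδ.ne').const_mul δ⁻¹
  exact h.congr (ae_of_all _ fun u => (poissonKer_eq_scaled hδ u).symm)

lemma integral_poissonKer {δ : ℝ} (hδ : 0 < δ) : ∫ u, poissonKer δ u = Real.pi := by
  have h : poissonKer δ = fun u => δ⁻¹ * (fun v : ℝ => (1 + v ^ 2)⁻¹) (u / δ) := by
    ext u; exact poissonKer_eq_scaled hδ u
  rw [h, integral_const_mul, Measure.integral_comp_div (fun v : ℝ => (1 + v ^ 2)⁻¹),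
    integral_univ_inv_one_add_sq,
    abs_of_pos hδ, smul_eq_mul, inv_mul_cancel_left₀ hδ.ne']

lemma lintegral_poissonKer {δ : ℝ} (hδ : 0 < δ) :
    ∫⁻ u, ENNReal.ofReal (poissonKer δ u) = ENNReal.ofReal Real.pi := by
  rw [← integral_poissonKer hδ, ofReal_integral_eq_lintegral_ofReal
    (integrable_poissonKer_volume hδ) (ae_of_all _ (poissonKer_nonneg hδ))]

/-- A trilinear form in one function is bounded by its `L³` norm when the kernels have
bounded integral. -/
lemma lintegral_mul_sq_le {p V : ℝ → ℝ≥0∞} (hp : Measurable p) (hV : Measurable V) :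
    ∫⁻ x, V x * (∫⁻ y, V y * p (x - y)) ^ 2 ≤ 3 * (∫⁻ u, p u) ^ 2 * ∫⁻ x, V x ^ 3 := by
  set c := ∫⁻ u, p u with hc
  have hcr : ∀ x, ∫⁻ y, p (x - y) = c := fun x => lintegral_sub_left_eq_self p x
  have hcl : ∀ y, ∫⁻ x, p (x - y) = c := fun y => lintegral_sub_right_eq_self p y
  have amgm : ∀ a b d : ℝ≥0∞, a * b * d ≤ a ^ 3 + b ^ 3 + d ^ 3 := by
    intro a b d
    have h : a * b * d ≤ max a (max b d) ^ 3 := by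
      rw [pow_succ, sq]
      gcongr <;> simp
    refine h.trans ?_
    rcases max_choice a (max b d) with h | h
    · rw [h]; exact (le_add_right le_rfl).trans (le_add_right le_rfl)
    · rw [h]
      rcases max_choice b d with h | h
      · rw [h]; exact (le_add_left le_rfl).trans (le_add_right le_rfl)
      · rw [h]; exact le_add_left le_rfl
  have h1 : ∀ x, V x * (∫⁻ y, V y * p (x - y)) ^ 2
      ≤ c ^ 2 * V x ^ 3 + 2 * c * ∫⁻ y, V y ^ 3 * p (x - y) := by
    intro x
    have e : V x * (∫⁻ y, V y * p (x - y)) ^ 2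
        = ∫⁻ y, ∫⁻ z, V x * V y * V z * (p (x - y) * p (x - z)) := by
      have : ∀ y, ∫⁻ z, V x * V y * V z * (p (x - y) * p (x - z))
          = V x * (V y * p (x - y)) * ∫⁻ z, V z * p (x - z) := by
        intro y
        rw [← lintegral_const_mul _ (by fun_prop)]
        congr 1; ext z; ring
      simp_rw [this]
      rw [lintegral_mul_const _ (by fun_prop), lintegral_const_mul _ (by fun_prop)]
      ring
    rw [e]
    calc _ ≤ ∫⁻ y, ∫⁻ z, (V x ^ 3 + V y ^ 3 + V z ^ 3) * (p (x - y) * p (x - z)) := by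
          gcongr with y z; exact amgm _ _ _
      _ = ∫⁻ y, ((V x ^ 3 * c) * p (x - y) + c * (V y ^ 3 * p (x - y))
            + (∫⁻ z, V z ^ 3 * p (x - z)) * p (x - y)) := by
          congr 1; ext y
          have : ∀ z, (V x ^ 3 + V y ^ 3 + V z ^ 3) * (p (x - y) * p (x - z))
              = ((V x ^ 3 + V y ^ 3) * p (x - y)) * p (x - z)
                + p (x - y) * (V z ^ 3 * p (x - z)) := fun z => by ring
          simp_rw [this]
          rw [lintegral_add_left (by fun_prop), lintegral_const_mul _ (by fun_prop),
            lintegral_const_mul _ (by fun_prop), hcr]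
          ring
      _ = _ := by
          rw [lintegral_add_left (by fun_prop), lintegral_add_left (by fun_prop),
            lintegral_const_mul _ (by fun_prop), lintegral_const_mul _ (by fun_prop),
            lintegral_const_mul _ (by fun_prop), hcr]
          ring
  have h2 : ∫⁻ x, ∫⁻ y, V y ^ 3 * p (x - y) = c * ∫⁻ x, V x ^ 3 := by
    rw [lintegral_lintegral_swap (by fun_prop)]
    have : ∀ y, ∫⁻ x, V y ^ 3 * p (x - y) = V y ^ 3 * c := fun y => by
      rw [lintegral_const_mul _ (by fun_prop), hcl]
    simp_rw [this]
    rw [lintegral_mul_const _ (by fun_prop), mul_comm]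
  calc _ ≤ ∫⁻ x, (c ^ 2 * V x ^ 3 + 2 * c * ∫⁻ y, V y ^ 3 * p (x - y)) := lintegral_mono h1
    _ = c ^ 2 * (∫⁻ x, V x ^ 3) + 2 * c * (c * ∫⁻ x, V x ^ 3) := by
        rw [lintegral_add_left (by fun_prop), lintegral_const_mul _ (by fun_prop),
          lintegral_const_mul _ ?_, h2]
        exact Measurable.lintegral_prod_right' (f := fun q : ℝ × ℝ => V q.2 ^ 3 * p (q.1 - q.2))
          (by fun_prop)
    _ = _ := by ring

/-- For a finite measure with density in `L³` the Poisson integrals are bounded in `L²` of that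
measure, uniformly in the height. -/
lemma exists_integral_poisson_sq_le {V : ℝ → ℝ≥0∞} (hV : Measurable V)
    (h3 : ∫⁻ x, V x ^ 3 ≠ ∞) [IsFiniteMeasure (volume.withDensity V)] :
    ∃ A : ℝ, ∀ δ : ℝ, 0 < δ →
      ∫ x, (∫ y, poissonKer δ (x - y) ∂(volume.withDensity V)) ^ 2 ∂(volume.withDensity V) ≤ A := by
  refine ⟨(3 * (ENNReal.ofReal Real.pi) ^ 2 * ∫⁻ x, V x ^ 3).toReal, fun δ hδ => ?_⟩
  set ν := volume.withDensity V
  have mp := measurable_poissonKer δ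
  have hP : ∀ x, ENNReal.ofReal (∫ y, poissonKer δ (x - y) ∂ν)
      = ∫⁻ y, V y * ENNReal.ofReal (poissonKer δ (x - y)) := by
    intro x
    rw [ofReal_integral_eq_lintegral_ofReal (integrable_poissonKer hδ ν x)
      (ae_of_all _ fun y => poissonKer_nonneg hδ _)]
    exact lintegral_withDensity_eq_lintegral_mul _ hV (by fun_prop)
  have hPm : Measurable fun x => ∫⁻ y, V y * ENNReal.ofReal (poissonKer δ (x - y)) :=
    Measurable.lintegral_prod_right'
      (f := fun q : ℝ × ℝ => V q.2 * ENNReal.ofReal (poissonKer δ (q.1 - q.2))) (by fun_prop)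
  have hPb : ∀ u, |poissonKer δ u| ≤ 1 / δ := fun u => by
    rw [abs_of_nonneg (poissonKer_nonneg hδ _)]; exact poissonKer_le hδ _
  have key : ENNReal.ofReal (∫ x, (∫ y, poissonKer δ (x - y) ∂ν) ^ 2 ∂ν)
      ≤ 3 * (ENNReal.ofReal Real.pi) ^ 2 * ∫⁻ x, V x ^ 3 := by
    rw [ofReal_integral_eq_lintegral_ofReal (integrable_sq_integral ν ν mp hPb)
      (ae_of_all _ fun x => sq_nonneg _), ← lintegral_poissonKer hδ]
    have : ∀ x, ENNReal.ofReal ((∫ y, poissonKer δ (x - y) ∂ν) ^ 2)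
        = (∫⁻ y, V y * ENNReal.ofReal (poissonKer δ (x - y))) ^ 2 := fun x => by
      rw [ENNReal.ofReal_pow (integral_nonneg fun y => poissonKer_nonneg hδ _), hP]
    simp_rw [this]
    rw [lintegral_withDensity_eq_lintegral_mul _ hV (hPm.pow_const 2)]
    exact lintegral_mul_sq_le (p := fun u => ENNReal.ofReal (poissonKer δ u)) (by fun_prop) hV
  refine (ENNReal.ofReal_le_iff_le_toReal ?_).1 key
  exact ENNReal.mul_ne_top (by simp [ENNReal.mul_eq_top]) h3

/-! ### Lebesgue points -/

/-- The Poisson kernel is dominated by a rapidly decaying combination of indicators of dyadic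
dilates of `[-ε, ε]`. -/
lemma ofReal_poissonKer_le_tsum {ε : ℝ} (hε : 0 < ε) (x y : ℝ) :
    ENNReal.ofReal (poissonKer ε (x - y)) ≤ ∑' k : ℕ, ENNReal.ofReal (4 * (1 / 4) ^ k / ε) *
      (Metric.closedBall x (2 ^ k * ε)).indicator (fun _ => 1) y := by
  have hex : ∃ k : ℕ, |x - y| ≤ 2 ^ k * ε := by
    obtain ⟨k, hk⟩ := pow_unbounded_of_one_lt (|x - y| / ε) (one_lt_two)
    exact ⟨k, by rw [← div_le_iff₀ hε]; exact hk.le⟩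
  classical
  set k := Nat.find hex with hk
  have hk1 : |x - y| ≤ 2 ^ k * ε := Nat.find_spec hex
  refine le_trans ?_ (ENNReal.le_tsum k)
  have hmem : y ∈ Metric.closedBall x (2 ^ k * ε) := by
    rw [Metric.mem_closedBall, dist_comm, Real.dist_eq]; exact hk1
  rw [Set.indicator_of_mem hmem, mul_one]
  apply ENNReal.ofReal_le_ofReal
  rcases Nat.eq_zero_or_pos k with h0 | hpos
  · rw [h0]
    refine (poissonKer_le hε _).trans ?_
    gcongr
    norm_num
  · have hlt : 2 ^ (k - 1) * ε < |x - y| := not_le.1 (Nat.find_min hex (Nat.sub_lt hpos one_pos))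
    obtain ⟨m, hm⟩ : ∃ m, k = m + 1 := ⟨k - 1, by omega⟩
    rw [hm] at hlt ⊢
    simp only [Nat.add_sub_cancel] at hlt
    have h2 : (2 ^ m * ε) ^ 2 ≤ (x - y) ^ 2 := by
      rw [← sq_abs (x - y)]
      exact pow_le_pow_left₀ (by positivity) hlt.le 2
    have h4 : (1 / 4 : ℝ) ^ m * 4 ^ m = 1 := by rw [← mul_pow]; norm_num
    have h5 : ((2 : ℝ) ^ m) ^ 2 = 4 ^ m := by rw [← pow_mul, mul_comm, pow_mul]; norm_num
    rw [mul_pow, h5] at h2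
    have e : 4 * (1 / 4 : ℝ) ^ (m + 1) = (1 / 4) ^ m := by ring
    unfold poissonKer
    rw [e, div_le_div_iff₀ (by positivity) hε]
    have h6 : (1 / 4 : ℝ) ^ m * (4 ^ m * ε ^ 2) ≤ (1 / 4) ^ m * (x - y) ^ 2 := by gcongr
    have h7 : 0 ≤ (1 / 4 : ℝ) ^ m * ε ^ 2 := by positivity
    nlinarith

/-- Poisson averages of a function vanish in the limit if its averages over small balls do. -/
lemma tendsto_lintegral_poissonKer {φ : ℝ → ℝ≥0∞} (hφ : AEMeasurable φ) (x : ℝ) {B : ℝ≥0∞}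
    (hB : B ≠ ∞)
    (hbd : ∀ r : ℝ, 0 < r →
      (∫⁻ y in Metric.closedBall x r, φ y) / volume (Metric.closedBall x r) ≤ B)
    (hlim : Tendsto (fun r : ℝ =>
      (∫⁻ y in Metric.closedBall x r, φ y) / volume (Metric.closedBall x r)) (𝓝[>] 0) (𝓝 0)) :
    Tendsto (fun ε => ∫⁻ y, ENNReal.ofReal (poissonKer ε (x - y)) * φ y) (𝓝[>] 0) (𝓝 0) := by
  set a : ℝ → ℝ≥0∞ := fun r =>
    (∫⁻ y in Metric.closedBall x r, φ y) / volume (Metric.closedBall x r) with ha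
  have haM : ∀ r : ℝ, 0 < r →
      ∫⁻ y in Metric.closedBall x r, φ y = a r * ENNReal.ofReal (2 * r) := by
    intro r hr
    rw [ha]
    simp only [Real.volume_closedBall]
    rw [ENNReal.div_mul_cancel (by simpa using hr) ENNReal.ofReal_ne_top]
  have hle : ∀ ε : ℝ, 0 < ε → ∫⁻ y, ENNReal.ofReal (poissonKer ε (x - y)) * φ y
      ≤ ∫⁻ k : ℕ, ENNReal.ofReal (8 * (1 / 2) ^ k) * a (2 ^ k * ε) ∂Measure.count := by
    intro ε hε
    calc _ ≤ ∫⁻ y, ∑' k : ℕ, ENNReal.ofReal (4 * (1 / 4) ^ k / ε) *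
            (Metric.closedBall x (2 ^ k * ε)).indicator φ y := by
          refine lintegral_mono fun y => ?_
          refine (mul_le_mul_left (ofReal_poissonKer_le_tsum hε x y) _).trans_eq ?_
          rw [← ENNReal.tsum_mul_right]
          congr 1; ext k
          by_cases h : y ∈ Metric.closedBall x (2 ^ k * ε)
          · simp [Set.indicator_of_mem h]
          · simp [Set.indicator_of_notMem h]
      _ = ∑' k : ℕ, ENNReal.ofReal (8 * (1 / 2) ^ k) * a (2 ^ k * ε) := by
          rw [lintegral_tsum fun k =>
            (hφ.indicator Metric.isClosed_closedBall.measurableSet).const_mul _]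
          congr 1; ext k
          rw [lintegral_const_mul' _ _ ENNReal.ofReal_ne_top,
            lintegral_indicator Metric.isClosed_closedBall.measurableSet,
            haM _ (by positivity), mul_left_comm, mul_comm, ← ENNReal.ofReal_mul (by positivity)]
          congr 2
          have : (1 / 4 : ℝ) ^ k * 2 ^ k = (1 / 2) ^ k := by rw [← mul_pow]; norm_num
          rw [← this]
          field_simp
          ring
      _ = _ := (lintegral_count _).symm
  have hlim2 : Tendsto (fun ε : ℝ =>
      ∫⁻ k : ℕ, ENNReal.ofReal (8 * (1 / 2) ^ k) * a (2 ^ k * ε) ∂Measure.count)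
      (𝓝[>] 0) (𝓝 (∫⁻ k : ℕ, 0 ∂Measure.count)) := by
    refine tendsto_lintegral_filter_of_dominated_convergence
      (fun k : ℕ => ENNReal.ofReal (8 * (1 / 2) ^ k) * B)
      (Eventually.of_forall fun ε => measurable_of_countable _) ?_ ?_ ?_
    · filter_upwards [self_mem_nhdsWithin] with ε hε
      refine ae_of_all _ fun k => ?_
      have := hbd (2 ^ k * ε) (mul_pos (by positivity) hε)
      gcongr
    · rw [lintegral_count, ENNReal.tsum_mul_right]
      refine ENNReal.mul_ne_top ?_ hB
      rw [← ENNReal.ofReal_tsum_of_nonneg (fun k => by positivity)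
        ((summable_geometric_two).mul_left 8)]
      exact ENNReal.ofReal_ne_top
    · refine ae_of_all _ fun k => ?_
      have h1 : Tendsto (fun ε : ℝ => 2 ^ k * ε) (𝓝[>] 0) (𝓝[>] 0) := by
        refine tendsto_nhdsWithin_iff.2 ⟨?_, ?_⟩
        · have : Tendsto (fun ε : ℝ => 2 ^ k * ε) (𝓝 0) (𝓝 (2 ^ k * 0)) :=
            (continuous_const.mul continuous_id).tendsto 0
          rw [mul_zero] at this
          exact this.mono_left nhdsWithin_le_nhds
        · filter_upwards [self_mem_nhdsWithin] with ε hε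
          have hε : 0 < ε := hε
          exact Set.mem_Ioi.2 (by positivity)
      have := ENNReal.Tendsto.const_mul (a := ENNReal.ofReal (8 * (1 / 2) ^ k)) (hlim.comp h1)
        (Or.inr ENNReal.ofReal_ne_top)
      simpa using this
  rw [lintegral_zero] at hlim2
  refine tendsto_of_tendsto_of_tendsto_of_le_of_le' tendsto_const_nhds hlim2
    (Eventually.of_forall fun _ => zero_le) ?_
  filter_upwards [self_mem_nhdsWithin] with ε hε using hle ε hε

/-- At almost every point, the Poisson averages of the oscillation of an integrable function
tend to zero. -/
lemma ae_tendsto_lintegral_poissonKer_enorm_sub {g : ℝ → ℝ} (hg : Integrable g) :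
    ∀ᵐ x, Tendsto (fun ε => ∫⁻ y, ENNReal.ofReal (poissonKer ε (x - y)) * ‖g y - g x‖ₑ)
      (𝓝[>] 0) (𝓝 0) := by
  filter_upwards [(IsUnifLocDoublingMeasure.vitaliFamily (volume : Measure ℝ)
    1).ae_tendsto_lintegral_enorm_sub_div_of_integrable hg] with x hx
  have hlim := hx.comp (IsUnifLocDoublingMeasure.tendsto_closedBall_filterAt (K := 1)
    (l := 𝓝[>] (0 : ℝ)) (volume : Measure ℝ) (fun _ => x) id tendsto_id
    (by filter_upwards [self_mem_nhdsWithin] with r hr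
        simpa using (le_of_lt hr : (0 : ℝ) ≤ r)))
  obtain ⟨r₀, hr₀, hr⟩ : ∃ r₀ : ℝ, 0 < r₀ ∧ ∀ r : ℝ, 0 < r → r < r₀ →
      (∫⁻ y in Metric.closedBall x r, ‖g y - g x‖ₑ) / volume (Metric.closedBall x r) ≤ 1 := by
    have := hlim.eventually (eventually_le_nhds (zero_lt_one (α := ℝ≥0∞)))
    obtain ⟨r₀, hr₀, h⟩ := mem_nhdsGT_iff_exists_Ioo_subset.1 this
    exact ⟨r₀, hr₀, fun r h1 h2 => h ⟨h1, h2⟩⟩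
  refine tendsto_lintegral_poissonKer (by have := hg.1.aemeasurable; fun_prop) x
    (B := 1 + ((∫⁻ y, ‖g y‖ₑ) / ENNReal.ofReal (2 * r₀) + ‖g x‖ₑ)) ?_ (fun r hr0 => ?_) hlim
  · refine ENNReal.add_ne_top.2 ⟨ENNReal.one_ne_top, ENNReal.add_ne_top.2 ⟨?_, enorm_ne_top⟩⟩
    exact ENNReal.div_ne_top hg.2.ne (by simpa using hr₀)
  · rcases lt_or_ge r r₀ with h | h
    · exact (hr r hr0 h).trans (le_add_right le_rfl)
    · refine le_trans ?_ (le_add_left le_rfl)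
      have hb : ∫⁻ y in Metric.closedBall x r, ‖g y - g x‖ₑ
          ≤ (∫⁻ y, ‖g y‖ₑ) + ‖g x‖ₑ * volume (Metric.closedBall x r) := by
        calc _ ≤ ∫⁻ y in Metric.closedBall x r, (‖g y‖ₑ + ‖g x‖ₑ) :=
              lintegral_mono fun y => enorm_sub_le
          _ ≤ _ := by
              rw [lintegral_add_right _ measurable_const, setLIntegral_const]
              gcongr
              exact Measure.restrict_le_self
      have hv0 : volume (Metric.closedBall x r) ≠ 0 := by
        simpa [Real.volume_closedBall] using hr0
      have hvt : volume (Metric.closedBall x r) ≠ ∞ := by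
        exact measure_closedBall_lt_top.ne
      calc _ ≤ ((∫⁻ y, ‖g y‖ₑ) + ‖g x‖ₑ * volume (Metric.closedBall x r))
            / volume (Metric.closedBall x r) := by gcongr
        _ = (∫⁻ y, ‖g y‖ₑ) / volume (Metric.closedBall x r) + ‖g x‖ₑ := by
            rw [ENNReal.add_div, ENNReal.mul_div_cancel_right hv0 hvt]
        _ ≤ _ := by
            rw [Real.volume_closedBall]
            gcongr

/-- Odd kernels dominated by Poisson kernels annihilate integrable functions in the limit,
almost everywhere. -/
lemma ae_tendsto_integral_odd_kernel {g : ℝ → ℝ} (hg : Integrable g) {E : ℝ → ℝ → ℝ} {C : ℝ}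
    (hm : ∀ ε, Measurable (E ε)) (hodd : ∀ ε u, E ε (-u) = -E ε u)
    (hb : ∀ ε, 0 < ε → ∀ u, |E ε u| ≤ C * poissonKer ε u) :
    ∀ᵐ x, Tendsto (fun ε => ∫ y, E ε (x - y) * g y) (𝓝[>] 0) (𝓝 0) := by
  filter_upwards [ae_tendsto_lintegral_poissonKer_enorm_sub hg] with x hx
  rw [tendsto_zero_iff_enorm_tendsto_zero]
  have hx' := ENNReal.Tendsto.const_mul (a := ENNReal.ofReal C) hx (Or.inr ENNReal.ofReal_ne_top)
  rw [mul_zero] at hx'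
  refine tendsto_of_tendsto_of_tendsto_of_le_of_le' tendsto_const_nhds hx'
    (Eventually.of_forall fun _ => zero_le) ?_
  filter_upwards [self_mem_nhdsWithin] with ε hε
  have hε : 0 < ε := hε
  have hC : 0 ≤ C := by
    have h1 := (abs_nonneg _).trans (hb ε hε 0)
    have h2 : 0 < poissonKer ε 0 := by unfold poissonKer; positivity
    exact nonneg_of_mul_nonneg_left h1 h2
  have iE : Integrable (E ε) :=
    Integrable.mono' ((integrable_poissonKer_volume hε).const_mul C) (hm ε).aestronglyMeasurable
      (ae_of_all _ fun u => hb ε hε u)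
  have zE : ∫ u, E ε u = 0 := by
    have h1 := integral_neg_eq_self (E ε) volume
    simp_rw [hodd, integral_neg] at h1
    linarith
  have iEx : Integrable fun y => E ε (x - y) := iE.comp_sub_left x
  have iEg : Integrable fun y => E ε (x - y) * g y := by
    refine hg.bdd_mul (c := C * (1 / ε)) iEx.1 (ae_of_all _ fun y => ?_)
    exact (hb ε hε _).trans (by gcongr; exact poissonKer_le hε _)
  have e : ∫ y, E ε (x - y) * g y = ∫ y, E ε (x - y) * (g y - g x) := by
    simp_rw [mul_sub]
    rw [integral_sub iEg (iEx.mul_const _), integral_mul_const, integral_sub_left_eq_self (E ε), zE]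
    simp
  rw [e, ← lintegral_const_mul' _ _ ENNReal.ofReal_ne_top]
  refine (enorm_integral_le_lintegral_enorm _).trans (lintegral_mono fun y => ?_)
  rw [enorm_mul, ← mul_assoc, ← ENNReal.ofReal_mul hC]
  gcongr
  rw [Real.enorm_eq_ofReal_abs]
  exact ENNReal.ofReal_le_ofReal (hb ε hε _)

/-! ### Kernels: truncation and second differences of `s log |s|` -/

/-- The second difference with step one of the second primitive `s log |s| - s` of `1 / s`
(the linear term drops out). -/
noncomputable def logDiff (s : ℝ) : ℝ :=
  (s + 1) * Real.log (s + 1) + (s - 1) * Real.log (s - 1) - 2 * (s * Real.log s)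

/-- The kernel `1 / u` of the Hilbert transform, truncated at distance `ε`. -/
noncomputable def truncKer (ε u : ℝ) : ℝ := {v : ℝ | ε < |v|}.indicator (fun v => v⁻¹) u

lemma measurable_truncKer (ε : ℝ) : Measurable (truncKer ε) :=
  measurable_inv.indicator (measurableSet_lt measurable_const measurable_id.abs)

lemma truncKer_neg (ε u : ℝ) : truncKer ε (-u) = -truncKer ε u := by
  simp only [truncKer, Set.indicator_apply, Set.mem_ofPred_eq, abs_neg, inv_neg]
  split_ifs <;> simp

lemma abs_truncKer_le {ε : ℝ} (hε : 0 < ε) (u : ℝ) : |truncKer ε u| ≤ 1 / ε := by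
  simp only [truncKer, Set.indicator_apply, Set.mem_ofPred_eq]
  split_ifs with h
  · rw [abs_inv, one_div]; exact inv_anti₀ hε h.le
  · simp [hε.le]

lemma continuous_logDiff : Continuous logDiff := by
  unfold logDiff
  have h := Real.continuous_mul_log
  exact ((h.comp (continuous_add_const 1)).add (h.comp (continuous_id.sub continuous_const))).sub
    (continuous_const.mul h)

lemma logDiff_neg (s : ℝ) : logDiff (-s) = -logDiff s := by
  have h1 : Real.log (-s + 1) = Real.log (s - 1) := by rw [← Real.log_neg_eq_log]; congr 1; ring
  have h2 : Real.log (-s - 1) = Real.log (s + 1) := by rw [← Real.log_neg_eq_log]; congr 1; ring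
  rw [logDiff, logDiff, h1, h2, Real.log_neg_eq_log]
  ring

/-- Far from the origin the second difference of `s log |s|` agrees with `1 / s` to third order. -/
lemma abs_inv_sub_logDiff_le {s : ℝ} (hs : 2 < |s|) : |s⁻¹ - logDiff s| ≤ 6 * (s⁻¹) ^ 2 := by
  have hs0 : s ≠ 0 := by rintro rfl; norm_num at hs
  set x := s⁻¹ with hx
  have hxs : s * x = 1 := mul_inv_cancel₀ hs0
  have hx2 : |x| < 1 / 2 := by
    rw [hx, abs_inv, one_div]; exact inv_strictAnti₀ two_pos hs
  have hxl := abs_lt.1 hx2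
  have l1 : Real.log (s + 1) = Real.log s + Real.log (1 + x) := by
    rw [← Real.log_mul hs0 (by linarith), mul_add, hxs, mul_one]
  have l2 : Real.log (s - 1) = Real.log s + Real.log (1 - x) := by
    rw [← Real.log_mul hs0 (by linarith), mul_sub, hxs, mul_one]
  have cube : |x| ^ 3 / (1 - |x|) ≤ 2 * |x| ^ 3 := by
    rw [div_le_iff₀ (by linarith)]
    have : 0 ≤ |x| ^ 3 := by positivity
    nlinarith
  have e1 := Real.abs_log_sub_add_sum_range_le (x := -x) (by rw [abs_neg]; linarith) 2
  have e2 := (Real.abs_log_sub_add_sum_range_le (x := x) (by linarith) 2).trans cube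
  norm_num [Finset.sum_range_succ] at e1 e2
  set a := -x + x ^ 2 / 2 + Real.log (1 + x) with ha
  set b := x + x ^ 2 / 2 + Real.log (1 - x) with hb
  have e : x - logDiff s = -(s * (a + b) + (a - b)) := by
    rw [logDiff, l1, l2, ha, hb]
    linear_combination x * hxs
  have hsx : |s| * |x| = 1 := by rw [← abs_mul, hxs, abs_one]
  have hcube : |s| * |x| ^ 3 = x ^ 2 := by
    rw [pow_succ', ← mul_assoc, hsx, one_mul, sq_abs]
  have hc2 : |x| ^ 3 ≤ 1 / 2 * x ^ 2 := by
    rw [pow_succ', sq_abs]; gcongr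
  rw [e, abs_neg]
  calc |s * (a + b) + (a - b)| ≤ |s| * (|a| + |b|) + (|a| + |b|) := by
        refine (abs_add_le _ _).trans ?_
        rw [abs_mul]
        gcongr
        · exact abs_add_le _ _
        · exact abs_sub _ _
    _ ≤ |s| * (2 * |x| ^ 3 + 2 * |x| ^ 3) + (2 * |x| ^ 3 + 2 * |x| ^ 3) := by
        have := e1.trans cube
        gcongr
    _ = 4 * (|s| * |x| ^ 3) + 4 * |x| ^ 3 := by ring
    _ ≤ 6 * x ^ 2 := by rw [hcube]; linarith

/-- Near the origin both kernels are bounded, far from it they agree to third order. -/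
lemma exists_abs_truncKer_one_sub_logDiff_le :
    ∃ C : ℝ, ∀ s, |truncKer 1 s - logDiff s| ≤ C * poissonKer 1 s := by
  obtain ⟨C₀, hC₀⟩ := (isCompact_Icc (a := (-2 : ℝ)) (b := 2)).exists_bound_of_continuousOn
    continuous_logDiff.continuousOn
  have hC₀0 : 0 ≤ C₀ := (norm_nonneg _).trans (hC₀ 0 (by simp))
  refine ⟨12 + 5 * (C₀ + 1), fun s => ?_⟩
  unfold poissonKer
  rcases le_or_gt |s| 2 with h | h
  · have h1 := hC₀ s (abs_le.1 h)
    have h2 := abs_truncKer_le one_pos s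
    have h3 : |truncKer 1 s - logDiff s| ≤ C₀ + 1 := by
      refine (abs_sub _ _).trans ?_
      rw [Real.norm_eq_abs] at h1
      linarith
    refine h3.trans ?_
    rw [mul_one_div, le_div_iff₀ (by positivity)]
    have : s ^ 2 ≤ 4 := by rw [← sq_abs]; nlinarith [abs_nonneg s]
    nlinarith
  · have h1 : truncKer 1 s = s⁻¹ := by
      have : s ∈ {v : ℝ | 1 < |v|} := by rw [Set.mem_ofPred_eq]; linarith
      rw [truncKer, Set.indicator_of_mem this]
    rw [h1]
    refine (abs_inv_sub_logDiff_le h).trans ?_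
    have hs2 : 4 < s ^ 2 := by rw [← sq_abs]; nlinarith
    rw [inv_pow, mul_one_div, ← div_eq_mul_inv, div_le_div_iff₀ (by positivity) (by positivity)]
    nlinarith

lemma truncKer_scale {ε : ℝ} (hε : 0 < ε) (u : ℝ) : truncKer ε u = truncKer 1 (u / ε) / ε := by
  simp only [truncKer, Set.indicator_apply, Set.mem_ofPred_eq, abs_div, abs_of_pos hε,
    one_lt_div hε]
  split_ifs
  · field_simp
  · simp

lemma exists_abs_truncKer_sub_logDiff_le :
    ∃ C : ℝ, ∀ ε, 0 < ε → ∀ u, |truncKer ε u - logDiff (u / ε) / ε| ≤ C * poissonKer ε u := by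
  obtain ⟨C, hC⟩ := exists_abs_truncKer_one_sub_logDiff_le
  refine ⟨C, fun ε hε u => ?_⟩
  have hp : poissonKer ε u = poissonKer 1 (u / ε) / ε := by
    unfold poissonKer; field_simp
  rw [truncKer_scale hε, hp, ← sub_div, abs_div, abs_of_pos hε, ← mul_div_assoc]
  gcongr
  exact hC _

lemma abs_truncKer_sub_conjKer_le {ε : ℝ} (hε : 0 < ε) (u : ℝ) :
    |truncKer ε u - conjKer ε u| ≤ 1 * poissonKer ε u := by
  rw [one_mul]
  simp only [truncKer, Set.indicator_apply, Set.mem_ofPred_eq]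
  unfold conjKer poissonKer
  have hpos : 0 < u ^ 2 + ε ^ 2 := by positivity
  split_ifs with h
  · have hu : u ≠ 0 := by rintro rfl; simp at h; linarith
    have e : u⁻¹ - u / (u ^ 2 + ε ^ 2) = ε ^ 2 / u / (u ^ 2 + ε ^ 2) := by field_simp; ring
    rw [e, abs_div, abs_of_pos hpos]
    gcongr
    rw [abs_div, abs_of_pos (by positivity : 0 < ε ^ 2), div_le_iff₀ (by linarith)]
    nlinarith
  · rw [zero_sub, abs_neg, abs_div, abs_of_pos hpos]
    gcongr
    exact not_lt.1 h

/-- Also valid at `a = 0`, where both sides vanish. -/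
lemma mul_log_mul {ε : ℝ} (hε : 0 < ε) (a : ℝ) :
    ε * a * Real.log (ε * a) = ε * a * Real.log ε + ε * (a * Real.log a) := by
  rcases eq_or_ne a 0 with rfl | ha
  · simp
  · rw [Real.log_mul hε.ne' ha]; ring

/-- Averaging symmetric differences of `log |·|` produces the kernel `logDiff`. -/
lemma integral_log_sub_log {ε : ℝ} (hε : 0 < ε) (u : ℝ) :
    ∫ t in (0 : ℝ)..ε, (Real.log (u + t) - Real.log (u - t)) = ε ^ 2 * (logDiff (u / ε) / ε) := by
  have i1 : IntervalIntegrable (fun t => Real.log (u + t)) volume 0 ε := by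
    have := (intervalIntegral.intervalIntegrable_log' (a := u) (b := u + ε)).comp_add_left u
    simpa using this
  have i2 : IntervalIntegrable (fun t => Real.log (u - t)) volume 0 ε := by
    have := (intervalIntegral.intervalIntegrable_log' (a := u) (b := u - ε)).comp_sub_left u
    simpa using this
  rw [intervalIntegral.integral_sub i1 i2, intervalIntegral.integral_comp_add_left,
    intervalIntegral.integral_comp_sub_left, integral_log, integral_log]
  obtain ⟨s, rfl⟩ : ∃ s, u = ε * s := ⟨u / ε, by field_simp⟩
  have h1 := mul_log_mul hε (s + 1)
  have h2 := mul_log_mul hε (s - 1)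
  have h0 := mul_log_mul hε s
  rw [mul_div_cancel_left₀ _ hε.ne', logDiff]
  rw [mul_add, mul_one] at h1
  rw [mul_sub, mul_one] at h2
  rw [add_zero, sub_zero, h1, h2, h0]
  field_simp
  ring

/-! ### Variation and averaged symmetric differences -/

/-- The variation of a primitive is at most the `L¹` norm of its derivative. -/
lemma eVariationOn_le_of_hasDerivAt {f f' : ℝ → ℝ} (hf : ∀ x, HasDerivAt f (f' x) x)
    (hi : ∀ a b, IntervalIntegrable f' volume a b) (a b : ℝ) :
    eVariationOn f (Set.Icc a b) ≤ ENNReal.ofReal (∫ x in Set.Icc a b, |f' x|) := by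
  refine iSup_le fun p => ?_
  obtain ⟨n, u, hu, hmem⟩ := p
  have hstep : ∀ i, edist (f (u (i + 1))) (f (u i))
      ≤ ENNReal.ofReal (∫ x in u i..u (i + 1), |f' x|) := by
    intro i
    rw [edist_dist, Real.dist_eq, ← intervalIntegral.integral_eq_sub_of_hasDerivAt
      (fun x _ => hf x) (hi _ _)]
    exact ENNReal.ofReal_le_ofReal
      (intervalIntegral.abs_integral_le_integral_abs (hu (Nat.le_succ i)))
  have hpos : ∀ i, 0 ≤ ∫ x in u i..u (i + 1), |f' x| := fun i =>
    intervalIntegral.integral_nonneg (hu (Nat.le_succ i)) fun _ _ => abs_nonneg _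
  calc _ ≤ ∑ i ∈ Finset.range n, ENNReal.ofReal (∫ x in u i..u (i + 1), |f' x|) :=
        Finset.sum_le_sum fun i _ => hstep i
    _ = ENNReal.ofReal (∫ x in u 0..u n, |f' x|) := by
        rw [← ENNReal.ofReal_sum_of_nonneg fun i _ => hpos i,
          intervalIntegral.sum_integral_adjacent_intervals fun i _ => (hi _ _).abs]
    _ ≤ _ := by
        refine ENNReal.ofReal_le_ofReal ?_
        rw [intervalIntegral.integral_of_le (hu (Nat.zero_le n))]
        have hsub : Set.Ioc (u 0) (u n) ⊆ Set.Icc a b := fun x hx =>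
          ⟨(hmem 0).1.trans hx.1.le, hx.2.trans (hmem n).2⟩
        refine setIntegral_mono_set ?_ (ae_of_all _ fun _ => abs_nonneg _) hsub.eventuallyLE
        have hab : a ≤ b := (hmem 0).1.trans (hmem 0).2
        exact (intervalIntegrable_iff_integrableOn_Icc_of_le hab).1 (hi a b).abs

/-- If `ψ t / t → 2 d` as `t → 0⁺`, then `ε⁻²` times the integral of `ψ` over `[0, ε]` tends
to `d`. -/
lemma tendsto_inv_sq_mul_integral {ψ : ℝ → ℝ} {d : ℝ}
    (hi : ∀ ε, 0 < ε → IntervalIntegrable ψ volume 0 ε)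
    (hψ : Tendsto (fun t => ψ t / t) (𝓝[>] 0) (𝓝 (2 * d))) :
    Tendsto (fun ε => (ε ^ 2)⁻¹ * ∫ t in (0 : ℝ)..ε, ψ t) (𝓝[>] 0) (𝓝 d) := by
  rw [Metric.tendsto_nhds] at hψ ⊢
  intro η hη
  obtain ⟨r, hr, h⟩ := mem_nhdsGT_iff_exists_Ioo_subset.1 (hψ η hη)
  filter_upwards [Ioo_mem_nhdsGT (show (0 : ℝ) < r from hr)] with ε hε
  have e1 : ∫ t in (0 : ℝ)..ε, 2 * d * t = d * ε ^ 2 := by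
    rw [intervalIntegral.integral_const_mul, integral_id]; ring
  have e2 : ∫ t in (0 : ℝ)..ε, η * t = η * ε ^ 2 / 2 := by
    rw [intervalIntegral.integral_const_mul, integral_id]; ring
  have hlin : ∀ c : ℝ, IntervalIntegrable (fun t => c * t) volume 0 ε := fun c =>
    (continuous_const.mul continuous_id).intervalIntegrable _ _
  have hle : |∫ t in (0 : ℝ)..ε, (ψ t - 2 * d * t)| ≤ ∫ t in (0 : ℝ)..ε, η * t := by
    rw [← Real.norm_eq_abs]
    refine intervalIntegral.norm_integral_le_of_norm_le hε.1.le (ae_of_all _ ?_) (hlin η)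
    intro t ht
    have ht' : dist (ψ t / t) (2 * d) < η := h ⟨ht.1, ht.2.trans_lt hε.2⟩
    have e : ψ t - 2 * d * t = (ψ t / t - 2 * d) * t := by
      have := ht.1.ne'
      field_simp
    rw [Real.dist_eq] at ht'
    rw [e, norm_mul, Real.norm_eq_abs, Real.norm_eq_abs, abs_of_pos ht.1]
    have := ht.1
    gcongr
  rw [intervalIntegral.integral_sub (hi ε hε.1) (hlin (2 * d)), e1, e2] at hle
  have hε2 : 0 < ε ^ 2 := pow_pos hε.1 2
  have hε0 : ε ≠ 0 := hε.1.ne'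
  rw [Real.dist_eq]
  have e3 : (ε ^ 2)⁻¹ * ∫ t in (0 : ℝ)..ε, ψ t
      = (ε ^ 2)⁻¹ * ((∫ t in (0 : ℝ)..ε, ψ t) - d * ε ^ 2) + d := by
    field_simp; ring
  rw [e3, add_sub_cancel_right, abs_mul, abs_of_pos (inv_pos.2 hε2)]
  calc _ ≤ (ε ^ 2)⁻¹ * (η * ε ^ 2 / 2) := by gcongr
    _ = η / 2 := by field_simp
    _ < η := half_lt_self hη

/-- Averages of symmetric differences of a differentiable function recover its derivative. -/
lemma HasDerivAt.tendsto_inv_sq_mul_integral {Φ : ℝ → ℝ} {x d : ℝ} (h : HasDerivAt Φ d x)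
    (hi : ∀ ε, 0 < ε → IntervalIntegrable (fun t => Φ (x + t) - Φ (x - t)) volume 0 ε) :
    Tendsto (fun ε => (ε ^ 2)⁻¹ * ∫ t in (0 : ℝ)..ε, (Φ (x + t) - Φ (x - t))) (𝓝[>] 0) (𝓝 d) := by
  refine _root_.tendsto_inv_sq_mul_integral hi ?_
  have h1 : HasDerivAt (fun t => Φ (x + t) - Φ (x - t)) (2 * d) 0 := by
    have a1 : HasDerivAt (fun t => Φ (x + t)) d 0 := by
      have := HasDerivAt.comp_const_add (f := Φ) (f' := d) x 0 (by simpa using h)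
      simpa using this
    have a2 : HasDerivAt (fun t => Φ (x - t)) (-d) 0 := by
      have := HasDerivAt.comp_const_sub (f := Φ) (f' := d) x 0 (by simpa using h)
      simpa using this
    exact (a1.fun_sub a2).congr_deriv (by ring)
  have h2 := hasDerivAt_iff_tendsto_slope.1 h1
  refine (h2.mono_left (nhdsWithin_mono _ fun t ht => ne_of_gt ht)).congr fun t => ?_
  simp [slope_def_field]

/-- Joint integrability behind the averaging of the logarithmic potential: the logarithm is locally
integrable, and `g` is integrable with bounded support. -/
lemma integrable_mul_log_sub_log {g : ℝ → ℝ} {R : ℝ} (hg : Integrable g)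
    (hR : ∀ y, R < |y| → g y = 0) (x ε : ℝ) (hε : 0 < ε) :
    Integrable (fun p : ℝ × ℝ => g p.2 * (Real.log (x - p.2 + p.1) - Real.log (x - p.2 - p.1)))
      ((volume.restrict (Set.Ioc 0 ε)).prod volume) := by
  have hmeas : AEStronglyMeasurable
      (fun p : ℝ × ℝ => g p.2 * (Real.log (x - p.2 + p.1) - Real.log (x - p.2 - p.1)))
      ((volume.restrict (Set.Ioc 0 ε)).prod volume) := by
    refine hg.1.comp_snd.mul (Measurable.aestronglyMeasurable ?_)
    fun_prop
  have i1 : ∀ u, IntervalIntegrable (fun t => Real.log (u + t)) volume 0 ε := fun u => by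
    simpa using (intervalIntegral.intervalIntegrable_log' (a := u) (b := u + ε)).comp_add_left u
  have i2 : ∀ u, IntervalIntegrable (fun t => Real.log (u - t)) volume 0 ε := fun u => by
    simpa using (intervalIntegral.intervalIntegrable_log' (a := u) (b := u - ε)).comp_sub_left u
  set M := |x| + R + ε with hM
  have hlog : ∀ a b, IntervalIntegrable (fun t => |Real.log t|) volume a b := fun a b =>
    intervalIntegral.intervalIntegrable_log'.abs
  rw [integrable_prod_iff' hmeas]
  refine ⟨ae_of_all _ fun y => ?_, ?_⟩
  · exact (((i1 (x - y)).sub (i2 (x - y))).1).const_mul (g y)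
  · refine Integrable.mono' (hg.norm.mul_const (2 * ∫ v in -M..M, |Real.log v|))
      hmeas.norm.prod_swap.integral_prod_right' (ae_of_all _ fun y => ?_)
    have hnn : 0 ≤ ∫ t in Set.Ioc 0 ε,
        ‖g y * (Real.log (x - y + t) - Real.log (x - y - t))‖ :=
      integral_nonneg fun _ => norm_nonneg _
    rw [Real.norm_of_nonneg hnn]
    simp_rw [norm_mul]
    rw [integral_const_mul]
    rcases lt_or_ge R |y| with hy | hy
    · simp [hR y hy]
    gcongr
    have hu : |x - y| ≤ |x| + R := (abs_sub _ _).trans (by linarith)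
    have hu' := abs_le.1 hu
    have b1 : ∫ t in (0 : ℝ)..ε, |Real.log (x - y + t)| ≤ ∫ v in -M..M, |Real.log v| := by
      rw [intervalIntegral.integral_comp_add_left (fun v => |Real.log v|)]
      refine intervalIntegral.integral_mono_interval ?_ ?_ ?_ (ae_of_all _ fun _ => abs_nonneg _)
        (hlog _ _) <;> linarith
    have b2 : ∫ t in (0 : ℝ)..ε, |Real.log (x - y - t)| ≤ ∫ v in -M..M, |Real.log v| := by
      rw [intervalIntegral.integral_comp_sub_left (fun v => |Real.log v|)]
      refine intervalIntegral.integral_mono_interval ?_ ?_ ?_ (ae_of_all _ fun _ => abs_nonneg _)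
        (hlog _ _) <;> linarith
    rw [← intervalIntegral.integral_of_le hε.le]
    calc _ ≤ ∫ t in (0 : ℝ)..ε, (|Real.log (x - y + t)| + |Real.log (x - y - t)|) := by
          refine intervalIntegral.integral_mono_on hε.le ((i1 _).sub (i2 _)).norm
            ((i1 _).abs.add (i2 _).abs) fun t _ => abs_sub _ _
      _ ≤ _ := by
          rw [intervalIntegral.integral_add (i1 _).abs (i2 _).abs]
          linarith

/-- Symmetric differences of the logarithmic potential, averaged, are convolutions
with `logDiff`. -/
lemma integral_logPotential_sub {g : ℝ → ℝ} {R : ℝ} (hg : Integrable g)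
    (hR : ∀ y, R < |y| → g y = 0) (hlog : ∀ x, Integrable fun y => g y * Real.log (x - y))
    (x ε : ℝ) (hε : 0 < ε) :
    IntervalIntegrable (fun t => (∫ y, g y * Real.log (x + t - y))
      - ∫ y, g y * Real.log (x - t - y)) volume 0 ε ∧
    (ε ^ 2)⁻¹ * ∫ t in (0 : ℝ)..ε, ((∫ y, g y * Real.log (x + t - y))
      - ∫ y, g y * Real.log (x - t - y)) = ∫ y, logDiff ((x - y) / ε) / ε * g y := by
  have hi := integrable_mul_log_sub_log hg hR x ε hε
  have e : ∀ t, (∫ y, g y * Real.log (x + t - y)) - ∫ y, g y * Real.log (x - t - y)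
      = ∫ y, g y * (Real.log (x - y + t) - Real.log (x - y - t)) := by
    intro t
    rw [← integral_sub (hlog _) (hlog _)]
    congr 1; ext y
    rw [mul_sub, add_sub_right_comm, sub_right_comm]
  simp_rw [e]
  refine ⟨(intervalIntegrable_iff_integrableOn_Ioc_of_le hε.le).2 hi.integral_prod_left, ?_⟩
  rw [intervalIntegral.integral_of_le hε.le, integral_integral_swap hi, ← integral_const_mul]
  congr 1; ext y
  rw [integral_const_mul, ← intervalIntegral.integral_of_le hε.le, integral_log_sub_log hε]
  field_simp

/-! ### The logarithmic potential and existence of principal values -/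

lemma abs_half_log_sq_add_sq_le {δ u : ℝ} (hδ : 0 < δ) (hδ1 : δ ≤ 1) (hu : u ≠ 0) :
    |1 / 2 * Real.log (u ^ 2 + δ ^ 2)| ≤ |Real.log u| + 1 := by
  have hu2 : 0 < u ^ 2 := by positivity
  have lo : Real.log u ≤ 1 / 2 * Real.log (u ^ 2 + δ ^ 2) := by
    have := Real.log_le_log hu2 (show u ^ 2 ≤ u ^ 2 + δ ^ 2 by nlinarith)
    rw [Real.log_pow] at this
    push_cast at this
    linarith
  have hi : 1 / 2 * Real.log (u ^ 2 + δ ^ 2) ≤ |Real.log u| + 1 := by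
    have hlog2 : Real.log 2 ≤ 1 := by linarith [Real.log_two_lt_d9]
    have hδ2 : δ ^ 2 ≤ 1 := by nlinarith
    rcases le_total (u ^ 2) 1 with h | h
    · have h1 := Real.log_le_log (by positivity) (show u ^ 2 + δ ^ 2 ≤ 2 by linarith)
      have := abs_nonneg (Real.log u)
      linarith
    · have h1 := Real.log_le_log (by positivity) (show u ^ 2 + δ ^ 2 ≤ 2 * u ^ 2 by linarith)
      rw [Real.log_mul two_ne_zero hu2.ne', Real.log_pow] at h1
      push_cast at h1
      have := le_abs_self (Real.log u)
      linarith
  rw [abs_le]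
  exact ⟨by linarith [neg_abs_le (Real.log u)], hi⟩

section
variable {g : ℝ → ℝ}

lemma integrable_mul_half_log (hg : Integrable g)
    (hlog : ∀ x, Integrable fun y => g y * Real.log (x - y)) {δ : ℝ} (hδ : 0 < δ) (hδ1 : δ ≤ 1)
    (x : ℝ) : Integrable fun y => g y * (1 / 2 * Real.log ((x - y) ^ 2 + δ ^ 2)) := by
  refine Integrable.mono' ((hlog x).norm.add hg.norm) (hg.1.mul (Measurable.aestronglyMeasurable
    (by fun_prop))) ?_
  filter_upwards [Measure.ae_ne volume x] with y hy
  rw [Pi.add_apply, norm_mul (g y) (1 / 2 * _), norm_mul (g y) (Real.log _), ← mul_add_one]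
  gcongr
  exact abs_half_log_sq_add_sq_le hδ hδ1 (sub_ne_zero.2 hy.symm)

lemma hasDerivAt_smoothLogPotential (hg : Integrable g)
    (hlog : ∀ x, Integrable fun y => g y * Real.log (x - y)) {δ : ℝ} (hδ : 0 < δ) (hδ1 : δ ≤ 1)
    (x : ℝ) : HasDerivAt (fun x => ∫ y, g y * (1 / 2 * Real.log ((x - y) ^ 2 + δ ^ 2)))
      (∫ y, conjKer δ (x - y) * g y) x := by
  have hm := measurable_conjKer δ
  refine (hasDerivAt_integral_of_dominated_loc_of_deriv_le (s := Set.univ)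
    (F' := fun x y => conjKer δ (x - y) * g y)
    (bound := fun y => 1 / δ * ‖g y‖) Filter.univ_mem
    (Eventually.of_forall fun x => (integrable_mul_half_log hg hlog hδ hδ1 x).1)
    (integrable_mul_half_log hg hlog hδ hδ1 x) ?_ ?_ (hg.norm.const_mul _) ?_).2
  · exact Measurable.aestronglyMeasurable (by fun_prop) |>.mul hg.1
  · refine ae_of_all _ fun y z _ => ?_
    rw [norm_mul]
    gcongr
    exact abs_conjKer_le hδ _
  · refine ae_of_all _ fun y z _ => ?_
    have hpos : (z - y) ^ 2 + δ ^ 2 ≠ 0 := by positivity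
    have h1 : HasDerivAt (fun z => (z - y) ^ 2 + δ ^ 2) (2 * (z - y)) z := by
      simpa using (((hasDerivAt_id z).sub_const y).pow 2).add_const (δ ^ 2)
    refine (((h1.log hpos).const_mul (1 / 2)).const_mul (g y)).congr_deriv ?_
    unfold conjKer
    field_simp

/-- The logarithmic potential of `g` is the limit of its smooth regularizations, whose derivatives
are the conjugate Poisson integrals of `g`. -/
lemma boundedVariationOn_logPotential (hg : Integrable g)
    (hlog : ∀ x, Integrable fun y => g y * Real.log (x - y)) {a b K : ℝ}
    (hK : ∀ δ, 0 < δ → ∫ x in Set.Icc a b, |∫ y, conjKer δ (x - y) * g y| ≤ K) :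
    BoundedVariationOn (fun x => ∫ y, g y * Real.log (x - y)) (Set.Icc a b) := by
  have hlim : ∀ x, Tendsto (fun δ : ℝ => ∫ y, g y * (1 / 2 * Real.log ((x - y) ^ 2 + δ ^ 2)))
      (𝓝[>] 0) (𝓝 (∫ y, g y * Real.log (x - y))) := by
    intro x
    have hev : ∀ᶠ δ : ℝ in 𝓝[>] 0, δ ∈ Set.Ioc (0 : ℝ) 1 := Ioc_mem_nhdsGT one_pos
    refine tendsto_integral_filter_of_dominated_convergence
      (fun y => ‖g y * Real.log (x - y)‖ + ‖g y‖) ?_ ?_ ((hlog x).norm.add hg.norm) ?_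
    · filter_upwards [hev] with δ hδ using (integrable_mul_half_log hg hlog hδ.1 hδ.2 x).1
    · filter_upwards [hev] with δ hδ
      filter_upwards [Measure.ae_ne volume x] with y hy
      rw [norm_mul (g y) (1 / 2 * _), norm_mul (g y) (Real.log _), ← mul_add_one]
      gcongr
      exact abs_half_log_sq_add_sq_le hδ.1 hδ.2 (sub_ne_zero.2 hy.symm)
    · filter_upwards [Measure.ae_ne volume x] with y hy
      have hne : (x - y) ^ 2 + (0 : ℝ) ^ 2 ≠ 0 := by
        have := sub_ne_zero.2 hy.symm
        positivity
      have hc : ContinuousAt (fun δ : ℝ => g y * (1 / 2 * Real.log ((x - y) ^ 2 + δ ^ 2))) 0 := by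
        refine continuousAt_const.mul (continuousAt_const.mul (ContinuousAt.log ?_ hne))
        fun_prop
      have h0 := hc.tendsto.mono_left (nhdsWithin_le_nhds (s := Set.Ioi 0))
      have e : 1 / 2 * Real.log ((x - y) ^ 2 + 0 ^ 2) = Real.log (x - y) := by
        rw [zero_pow two_ne_zero, add_zero, Real.log_pow]
        push_cast
        ring
      rwa [e] at h0
  refine ne_top_of_le_ne_top (ENNReal.ofReal_ne_top (r := K)) (le_of_not_gt fun hlt => ?_)
  obtain ⟨δ, hδ, hδ1⟩ := ((eVariationOn.lowerSemicontinuous_aux (fun x _ => hlim x) hlt).and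
    (Ioc_mem_nhdsGT (zero_lt_one (α := ℝ)))).exists
  have hm := measurable_conjKer δ
  have hQ : ∀ a b, IntervalIntegrable (fun x => ∫ y, conjKer δ (x - y) * g y) volume a b := by
    intro a b
    have hsm : AEStronglyMeasurable (fun p : ℝ × ℝ => conjKer δ (p.1 - p.2) * g p.2)
        ((volume : Measure ℝ).prod volume) :=
      (Measurable.aestronglyMeasurable (by fun_prop)).mul hg.1.comp_snd
    rw [intervalIntegrable_iff]
    refine Measure.integrableOn_of_bounded (M := 1 / δ * ∫ y, ‖g y‖) (by simp)
      hsm.integral_prod_right' (ae_of_all _ fun x => ?_)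
    rw [← integral_const_mul]
    refine norm_integral_le_of_norm_le (hg.norm.const_mul _) (ae_of_all _ fun y => ?_)
    rw [norm_mul]
    gcongr
    exact abs_conjKer_le hδ1.1 _
  have := (eVariationOn_le_of_hasDerivAt (hasDerivAt_smoothLogPotential hg hlog hδ1.1 hδ1.2)
    hQ a b).trans (ENNReal.ofReal_le_ofReal (hK δ hδ1.1))
  exact absurd (hδ.trans_le this) (lt_irrefl _)

/-- Uniform local `L¹` bounds for the conjugate Poisson integrals of a compactly supported
function give the almost everywhere convergence of its truncated Hilbert transforms. The limit is
the derivative of the logarithmic potential. -/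
lemma ae_exists_tendsto_truncKer (hg : Integrable g) {R : ℝ}
    (hR : ∀ y, R < |y| → g y = 0)
    (hlog : ∀ x, Integrable fun y => g y * Real.log (x - y)) {a b K : ℝ} (hab : a ≤ b)
    (hK : ∀ δ, 0 < δ → ∫ x in Set.Icc a b, |∫ y, conjKer δ (x - y) * g y| ≤ K) :
    ∀ᵐ x, x ∈ Set.Icc a b → ∃ d : ℝ,
      Tendsto (fun ε => ∫ y, truncKer ε (x - y) * g y) (𝓝[>] 0) (𝓝 d) ∧
      Tendsto (fun ε => ∫ y, conjKer ε (x - y) * g y) (𝓝[>] 0) (𝓝 d) := by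
  have hbv := boundedVariationOn_logPotential hg hlog hK
  rw [← Set.uIcc_of_le hab] at hbv ⊢
  obtain ⟨C, hC⟩ := exists_abs_truncKer_sub_logDiff_le
  have hmT := measurable_truncKer
  have hmk := measurable_conjKer
  have hmL : Measurable logDiff := continuous_logDiff.measurable
  have l1 := ae_tendsto_integral_odd_kernel hg (E := fun ε u => truncKer ε u - logDiff (u / ε) / ε)
    (C := C) (fun ε => by fun_prop) (fun ε u => by
      rw [truncKer_neg, neg_div, logDiff_neg]; ring) hC
  have l2 := ae_tendsto_integral_odd_kernel hg (E := fun ε u => truncKer ε u - conjKer ε u)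
    (C := 1) (fun ε => by fun_prop) (fun ε u => by
      rw [truncKer_neg, conjKer_neg]; ring) (fun ε hε => abs_truncKer_sub_conjKer_le hε)
  filter_upwards [hbv.ae_differentiableAt_of_mem_uIcc, l1, l2] with x hx h1 h2 hxI
  have hd := (hx hxI).hasDerivAt
  set d := deriv (fun x => ∫ y, g y * Real.log (x - y)) x
  have h3 := hd.tendsto_inv_sq_mul_integral
    fun ε hε => (integral_logPotential_sub hg hR hlog x ε hε).1
  have iT : ∀ ε, 0 < ε → Integrable fun y => truncKer ε (x - y) * g y := fun ε hε =>
    hg.bdd_mul (c := 1 / ε) (Measurable.aestronglyMeasurable (by fun_prop))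
      (ae_of_all _ fun y => abs_truncKer_le hε _)
  have ik : ∀ ε, 0 < ε → Integrable fun y => conjKer ε (x - y) * g y := fun ε hε =>
    hg.bdd_mul (c := 1 / ε) (Measurable.aestronglyMeasurable (by fun_prop))
      (ae_of_all _ fun y => abs_conjKer_le hε _)
  have iL : ∀ ε, 0 < ε →
      Integrable fun y => (truncKer ε (x - y) - logDiff ((x - y) / ε) / ε) * g y :=
    fun ε hε => hg.bdd_mul (c := C * (1 / ε)) (Measurable.aestronglyMeasurable (by fun_prop))
      (ae_of_all _ fun y => (hC ε hε _).trans (by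
        have hC0 : 0 ≤ C := nonneg_of_mul_nonneg_left ((abs_nonneg _).trans (hC 1 one_pos 0))
          (by unfold poissonKer; norm_num)
        gcongr
        exact poissonKer_le hε _))
  have hT : Tendsto (fun ε => ∫ y, truncKer ε (x - y) * g y) (𝓝[>] 0) (𝓝 d) := by
    have := h1.add h3
    rw [zero_add] at this
    refine this.congr' ?_
    filter_upwards [self_mem_nhdsWithin] with ε hε
    rw [(integral_logPotential_sub hg hR hlog x ε hε).2]
    have iL' : Integrable fun y => logDiff ((x - y) / ε) / ε * g y := by
      refine ((iT ε hε).sub (iL ε hε)).congr (ae_of_all _ fun y => ?_)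
      simp only [Pi.sub_apply]
      ring
    rw [← integral_add (iL ε hε) iL']
    congr 1; ext y; ring
  refine ⟨d, hT, ?_⟩
  have := hT.sub h2
  rw [sub_zero] at this
  refine this.congr' ?_
  filter_upwards [self_mem_nhdsWithin] with ε hε
  have i2 : Integrable fun y => (truncKer ε (x - y) - conjKer ε (x - y)) * g y := by
    refine ((iT ε hε).sub (ik ε hε)).congr (ae_of_all _ fun y => ?_)
    simp only [Pi.sub_apply]
    ring
  rw [← integral_sub (iT ε hε) i2]
  congr 1; ext y; ring

end

/-! ### The Hilbert transform in `L²` of a measure: real scalars -/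

/-- Near zero `log⁴ t` is dominated by a multiple of `t ^ (-1 / 2)`. -/
lemma intervalIntegrable_log_pow_four (a b : ℝ) :
    IntervalIntegrable (fun t => Real.log t ^ 4) volume a b := by
  refine intervalIntegrable_of_even (fun x => by rw [Real.log_neg_eq_log]) fun x hx => ?_
  have h1 : IntervalIntegrable (fun t : ℝ => 4096 * t ^ (-(1 / 2) : ℝ) + t ^ 4) volume 0 x :=
    ((intervalIntegral.intervalIntegrable_rpow' (by norm_num)).const_mul _).add
      ((continuous_pow 4).intervalIntegrable _ _)
  refine h1.mono_fun (by fun_prop) ?_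
  rw [Set.uIoc_of_le hx.le]
  refine (ae_restrict_mem measurableSet_Ioc).mono fun t ht => ?_
  have ht0 : 0 < t := ht.1
  have hp : 0 < t ^ (-(1 / 2) : ℝ) := Real.rpow_pos_of_pos ht0 _
  simp only
  rw [Real.norm_of_nonneg (by positivity), Real.norm_of_nonneg (by positivity)]
  rcases le_total t 1 with h | h
  · have h2 := (Real.abs_log_mul_self_rpow_lt t (1 / 8) ht0 h (by norm_num)).le
    have h3 : (Real.log t * t ^ (1 / 8 : ℝ)) ^ 4 ≤ 4096 := by
      have := pow_le_pow_left₀ (abs_nonneg _) h2 4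
      norm_num at this
      have e := Even.pow_abs (show Even 4 by decide) (Real.log t * t ^ (1 / 8 : ℝ))
      rw [← e, abs_mul, mul_pow]
      linarith
    have e : (t ^ (1 / 8 : ℝ)) ^ 4 = t ^ (1 / 2 : ℝ) := by
      rw [← Real.rpow_natCast, ← Real.rpow_mul ht0.le]; norm_num
    rw [mul_pow, e] at h3
    have h5 : t ^ (1 / 2 : ℝ) * t ^ (-(1 / 2) : ℝ) = 1 := by
      rw [← Real.rpow_add ht0]; norm_num
    have h6 : Real.log t ^ 4 ≤ 4096 * t ^ (-(1 / 2) : ℝ) := by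
      calc Real.log t ^ 4 = Real.log t ^ 4 * (t ^ (1 / 2 : ℝ) * t ^ (-(1 / 2) : ℝ)) := by
            rw [h5, mul_one]
        _ = (Real.log t ^ 4 * t ^ (1 / 2 : ℝ)) * t ^ (-(1 / 2) : ℝ) := by ring
        _ ≤ _ := by gcongr
    have : 0 ≤ t ^ 4 := by positivity
    linarith
  · have h2 : Real.log t ≤ t := (Real.log_le_sub_one_of_pos ht0).trans (by linarith)
    have h3 : Real.log t ^ 4 ≤ t ^ 4 := pow_le_pow_left₀ (Real.log_nonneg h) h2 4
    linarith

lemma eLpNorm_two_eq_ofReal_sqrt {μ : Measure ℝ} {f : ℝ → ℝ} (hf : MemLp f 2 μ) :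
    eLpNorm f 2 μ = ENNReal.ofReal (√(∫ x, f x ^ 2 ∂μ)) := by
  rw [hf.eLpNorm_eq_integral_rpow_norm (by norm_num) (by norm_num), Real.sqrt_eq_rpow]
  simp

lemma eLpNorm_one_eq_ofReal_integral_abs {μ : Measure ℝ} {f : ℝ → ℝ} (hf : Integrable f μ) :
    eLpNorm f 1 μ = ENNReal.ofReal (∫ x, |f x| ∂μ) := by
  rw [eLpNorm_one_eq_lintegral_enorm, ← ofReal_integral_norm_eq_lintegral_enorm hf]
  simp only [Real.norm_eq_abs]

lemma aestronglyMeasurable_integral_kernel {μ σ : Measure ℝ} [SFinite μ] [SFinite σ]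
    {κ f : ℝ → ℝ} (hκ : Measurable κ) (hf : AEStronglyMeasurable f μ) :
    AEStronglyMeasurable (fun x => ∫ y, κ (x - y) * f y ∂μ) σ := by
  have : AEStronglyMeasurable (fun p : ℝ × ℝ => κ (p.1 - p.2) * f p.2) (σ.prod μ) :=
    (Measurable.aestronglyMeasurable (by fun_prop)).mul hf.comp_snd
  exact this.integral_prod_right'

lemma memLp_integral_conjKer {μ : Measure ℝ} [IsFiniteMeasure μ] {f : ℝ → ℝ} (hf : Integrable f μ)
    {δ : ℝ} (hδ : 0 < δ) (p : ℝ≥0∞) :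
    MemLp (fun x => ∫ y, conjKer δ (x - y) * f y ∂μ) p μ := by
  refine MemLp.of_bound (aestronglyMeasurable_integral_kernel (measurable_conjKer δ) hf.1)
    (1 / δ * ∫ y, ‖f y‖ ∂μ) (ae_of_all _ fun x => ?_)
  rw [← integral_const_mul]
  refine norm_integral_le_of_norm_le (hf.norm.const_mul _) (ae_of_all _ fun y => ?_)
  rw [norm_mul]
  gcongr
  exact abs_conjKer_le hδ _

/-- The `L∞ → L²` bound for densities with values in `[0, 1]`. -/
lemma integral_sq_conjKer_mul_le_of_nonneg {μ : Measure ℝ} [IsFiniteMeasure μ] {A δ : ℝ}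
    (hδ : 0 < δ) (hA : ∫ x, (∫ y, poissonKer δ (x - y) ∂μ) ^ 2 ∂μ ≤ A) {u : ℝ → ℝ}
    (hu : AEMeasurable u μ) (hu1 : ∀ᵐ x ∂μ, u x ≤ 1) :
    ∫ x, (∫ y, conjKer δ (x - y) * max (u y) 0 ∂μ) ^ 2 ∂μ ≤ 9 * A := by
  set σ := μ.withDensity fun y => ENNReal.ofReal (u y) with hσ
  have hle : σ ≤ μ := by
    calc σ ≤ μ.withDensity 1 := withDensity_mono (by
          filter_upwards [hu1] with x hx
          simpa using hx)
      _ = μ := withDensity_one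
  have : IsFiniteMeasure σ := isFiniteMeasure_of_le μ hle
  have e : ∀ x, ∫ y, conjKer δ (x - y) ∂σ = ∫ y, conjKer δ (x - y) * max (u y) 0 ∂μ := by
    intro x
    rw [hσ, integral_withDensity_eq_integral_toReal_smul₀ (by fun_prop)
      (ae_of_all _ fun _ => ENNReal.ofReal_lt_top)]
    congr 1; ext y
    rw [ENNReal.toReal_ofReal', smul_eq_mul, mul_comm]
  simp_rw [← e]
  exact (integral_conj_sq_le_of_le hle hδ).trans (by gcongr)

/-- The `L∞ → L²` bound for bounded functions. -/
lemma eLpNorm_conjKer_two_le {μ : Measure ℝ} [IsFiniteMeasure μ] {A δ : ℝ}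
    (hδ : 0 < δ) (hA : ∫ x, (∫ y, poissonKer δ (x - y) ∂μ) ^ 2 ∂μ ≤ A) {f : ℝ → ℝ}
    (hf : MemLp f 2 μ) :
    eLpNorm (fun x => ∫ y, conjKer δ (x - y) * f y ∂μ) 2 μ
      ≤ ENNReal.ofReal (6 * √A + 1) * eLpNorm f ∞ μ := by
  rcases eq_or_ne (eLpNorm f ∞ μ) ∞ with htop | htop
  · rw [htop, ENNReal.mul_top]
    · exact le_top
    · have := Real.sqrt_nonneg A
      simp only [ne_eq, ENNReal.ofReal_eq_zero, not_le]
      linarith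
  have hf1 : Integrable f μ := hf.integrable (by norm_num)
  have hA0 : 0 ≤ A := (integral_nonneg fun _ => sq_nonneg _).trans hA
  obtain ⟨B, hB⟩ : ∃ B : ℝ, B = (eLpNorm f ∞ μ).toReal := ⟨_, rfl⟩
  have hBn : 0 ≤ B := hB ▸ ENNReal.toReal_nonneg
  have hBe : eLpNorm f ∞ μ = ENNReal.ofReal B := by rw [hB, ENNReal.ofReal_toReal htop]
  have hfB : ∀ᵐ x ∂μ, |f x| ≤ B := by
    have := ae_le_eLpNormEssSup (f := f) (μ := μ)
    filter_upwards [this] with x hx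
    rw [← eLpNorm_exponent_top, hBe, Real.enorm_eq_ofReal_abs] at hx
    exact (ENNReal.ofReal_le_ofReal_iff hBn).1 hx
  have hu : AEMeasurable (fun x => f x / B) μ := hf1.1.aemeasurable.div_const B
  have hm : AEMeasurable (fun x => -(f x / B)) μ := hu.neg
  have b1 := integral_sq_conjKer_mul_le_of_nonneg hδ hA hu (by
    filter_upwards [hfB] with x hx
    exact div_le_one_of_le₀ ((le_abs_self _).trans hx) hBn)
  have b2 := integral_sq_conjKer_mul_le_of_nonneg hδ hA hm (by
    filter_upwards [hfB] with x hx
    rw [← neg_div]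
    exact div_le_one_of_le₀ ((neg_le_abs _).trans hx) hBn)
  have ip : Integrable (fun x => max (f x / B) 0) μ := (hf1.div_const B).pos_part
  have im : Integrable (fun x => max (-(f x / B)) 0) μ := (hf1.div_const B).neg_part
  set Qp := fun x => ∫ y, conjKer δ (x - y) * max (f y / B) 0 ∂μ with hQp
  set Qm := fun x => ∫ y, conjKer δ (x - y) * max (-(f y / B)) 0 ∂μ with hQm
  have mp : MemLp Qp 2 μ := memLp_integral_conjKer ip hδ 2
  have mm : MemLp Qm 2 μ := memLp_integral_conjKer im hδ 2
  have e : (fun x => ∫ y, conjKer δ (x - y) * f y ∂μ) = fun x => B * (Qp x - Qm x) := by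
    ext x
    have hk : ∀ {φ : ℝ → ℝ}, Integrable φ μ → Integrable (fun y => conjKer δ (x - y) * φ y) μ :=
      fun hφ => hφ.bdd_mul (c := 1 / δ) (integrable_conjKer hδ μ x).1
        (ae_of_all _ fun y => abs_conjKer_le hδ _)
    rw [hQp, hQm]
    simp only
    rw [← integral_sub (hk ip) (hk im), ← integral_const_mul]
    refine integral_congr_ae ?_
    filter_upwards [hfB] with y hy
    have h1 : max (f y / B) 0 - max (-(f y / B)) 0 = f y / B := by
      rcases le_total (f y / B) 0 with h | h
      · rw [max_eq_right h, max_eq_left (by linarith)]; ring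
      · rw [max_eq_left h, max_eq_right (by linarith)]; ring
    rw [← mul_sub, h1]
    rcases eq_or_ne B 0 with h0 | h0
    · rw [h0] at hy
      simp [abs_nonpos_iff.1 hy]
    · field_simp
  have e2 : eLpNorm (fun x => B * (Qp x - Qm x)) 2 μ
      = ENNReal.ofReal B * eLpNorm (Qp - Qm) 2 μ := by
    have := eLpNorm_const_smul (p := 2) (μ := μ) B (Qp - Qm)
    rw [Real.enorm_of_nonneg hBn] at this
    exact this
  rw [e, e2, hBe, mul_comm]
  gcongr
  refine (eLpNorm_sub_le mp.1 mm.1 (by norm_num)).trans ?_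
  rw [eLpNorm_two_eq_ofReal_sqrt mp, eLpNorm_two_eq_ofReal_sqrt mm,
    ← ENNReal.ofReal_add (Real.sqrt_nonneg _) (Real.sqrt_nonneg _)]
  apply ENNReal.ofReal_le_ofReal
  have h9 : √(9 * A) = 3 * √A := by
    rw [show (9 : ℝ) * A = 3 ^ 2 * A by norm_num, Real.sqrt_mul (by norm_num),
      Real.sqrt_sq (by norm_num)]
  have := (Real.sqrt_le_sqrt b1).trans_eq h9
  have := (Real.sqrt_le_sqrt b2).trans_eq h9
  linarith

/-- The `L² → L¹` bound for square integrable functions. -/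
lemma eLpNorm_conjKer_one_le {μ : Measure ℝ} [IsFiniteMeasure μ] {A δ : ℝ}
    (hδ : 0 < δ) (hA : ∫ x, (∫ y, poissonKer δ (x - y) ∂μ) ^ 2 ∂μ ≤ A) {f : ℝ → ℝ}
    (hf : MemLp f 2 μ) :
    eLpNorm (fun x => ∫ y, conjKer δ (x - y) * f y ∂μ) 1 μ
      ≤ ENNReal.ofReal (6 * √A + 1) * eLpNorm f 2 μ := by
  have hf1 : Integrable f μ := hf.integrable (by norm_num)
  rw [eLpNorm_one_eq_ofReal_integral_abs
    (memLp_one_iff_integrable.1 (memLp_integral_conjKer hf1 hδ 1)), eLpNorm_two_eq_ofReal_sqrt hf,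
    ← ENNReal.ofReal_mul (by positivity)]
  apply ENNReal.ofReal_le_ofReal
  refine (integral_abs_conj_le le_rfl le_rfl hδ hA hf).trans ?_
  gcongr
  linarith

section
variable {V : ℝ → NNReal} {R : ℝ}

lemma add_pow_three_le (a b : ℝ≥0∞) : (a + b) ^ 3 ≤ 8 * (a ^ 3 + b ^ 3) := by
  have h : a + b ≤ 2 * max a b := by
    rw [two_mul]; gcongr <;> simp
  calc (a + b) ^ 3 ≤ (2 * max a b) ^ 3 := by gcongr
    _ = 8 * max a b ^ 3 := by rw [mul_pow]; norm_num
    _ ≤ _ := by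
        gcongr
        rcases max_choice a b with h | h <;> rw [h]
        · exact le_add_right le_rfl
        · exact le_add_left le_rfl

lemma lintegral_lt_top_of_cube (hR : ∀ x, R < |x| → V x = 0)
    (h3 : ∫⁻ x, (V x : ℝ≥0∞) ^ 3 ≠ ∞) (hV : Measurable V) : ∫⁻ x, (V x : ℝ≥0∞) < ∞ := by
  calc ∫⁻ x, (V x : ℝ≥0∞)
      ≤ ∫⁻ x, ((V x : ℝ≥0∞) ^ 3 + (Set.Icc (-R) R).indicator 1 x) := by
        refine lintegral_mono fun x => ?_
        rcases lt_or_ge R |x| with h | h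
        · simp [hR x h]
        · rw [Set.indicator_of_mem (show x ∈ Set.Icc (-R) R from abs_le.1 h)]
          rcases le_total (V x : ℝ≥0∞) 1 with h1 | h1
          · exact h1.trans (le_add_left le_rfl)
          · exact (le_self_pow h1 (by norm_num)).trans (le_add_right le_rfl)
    _ = (∫⁻ x, (V x : ℝ≥0∞) ^ 3) + volume (Set.Icc (-R) R) := by
        rw [lintegral_add_left (by fun_prop), lintegral_indicator_one measurableSet_Icc]
    _ < ∞ := by
        rw [ENNReal.add_lt_top]
        exact ⟨h3.lt_top, isCompact_Icc.measure_lt_top⟩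

/-- Square integrable functions for a measure with `L³` density have everywhere convergent
logarithmic potentials. -/
lemma integrable_mul_log (hV : Measurable V) (hR0 : 0 ≤ R) (hR : ∀ x, R < |x| → V x = 0)
    (h3 : ∫⁻ x, (V x : ℝ≥0∞) ^ 3 ≠ ∞) {f : ℝ → ℝ}
    (hf : MemLp f 2 (volume.withDensity fun x => (V x : ℝ≥0∞))) (x : ℝ) :
    Integrable fun y => (V y : ℝ) * f y * Real.log (x - y) := by
  have hV1 : Integrable fun y => (V y : ℝ) := by
    refine ⟨by fun_prop, ?_⟩
    simpa [HasFiniteIntegral] using lintegral_lt_top_of_cube hR h3 hV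
  have hV3 : Integrable fun y => (V y : ℝ) ^ 3 := by
    refine ⟨by fun_prop, ?_⟩
    simpa [HasFiniteIntegral, enorm_pow] using h3.lt_top
  have hl4 : Integrable ((Set.Icc (-R) R).indicator fun y => Real.log (x - y) ^ 4) := by
    rw [integrable_indicator_iff measurableSet_Icc,
      ← intervalIntegrable_iff_integrableOn_Icc_of_le (by linarith)]
    simpa using (intervalIntegrable_log_pow_four (x + R) (x - R)).comp_sub_left x
  have hl : MemLp (fun y => Real.log (x - y)) 2 (volume.withDensity fun x => (V x : ℝ≥0∞)) := by
    refine (memLp_two_iff_integrable_sq (Measurable.aestronglyMeasurable (by fun_prop))).2 ?_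
    rw [integrable_withDensity_iff_integrable_smul hV]
    refine Integrable.mono' ((hl4.add hV1).add hV3)
      (Measurable.aestronglyMeasurable (by fun_prop)) (ae_of_all _ fun y => ?_)
    simp only [Pi.add_apply, NNReal.smul_def, smul_eq_mul]
    rw [Real.norm_of_nonneg (by positivity)]
    rcases lt_or_ge R |y| with h | h
    · have : y ∉ Set.Icc (-R) R := fun hy => h.not_ge (abs_le.2 hy)
      simp [hR y h, this]
    · rw [Set.indicator_of_mem (show y ∈ Set.Icc (-R) R from abs_le.1 h)]
      have h0 : (0 : ℝ) ≤ V y := (V y).2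
      -- `V log² ≤ V² + log⁴` and `V² ≤ V + V³`
      nlinarith [sq_nonneg ((V y : ℝ) - Real.log (x - y) ^ 2), 
        mul_nonneg h0 (sq_nonneg ((V y : ℝ) - 1))]
  have := hf.integrable_mul hl
  rw [integrable_withDensity_iff_integrable_smul hV] at this
  refine this.congr (ae_of_all _ fun y => ?_)
  simp only [Pi.mul_apply, NNReal.smul_def, smul_eq_mul]
  ring

/-- The Hilbert transform of `f dμ`, for `μ` compactly supported with `L³` density, exists almost
everywhere as a principal value and is bounded `L² → L¹` and `L∞ → L²`: real scalars. -/
theorem exists_hilbert_real (hV : Measurable V) (hR0 : 0 ≤ R) (hR : ∀ x, R < |x| → V x = 0)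
    (h3 : ∫⁻ x, (V x : ℝ≥0∞) ^ 3 ≠ ∞) {μ : Measure ℝ}
    (hμ : μ = volume.withDensity fun x => (V x : ℝ≥0∞)) :
    ∃ C : ℝ≥0∞, C ≠ ∞ ∧ ∀ f : ℝ → ℝ, MemLp f 2 μ → ∃ h : ℝ → ℝ,
      AEStronglyMeasurable h μ ∧
      (∀ᵐ x ∂μ, Tendsto (fun ε => ∫ y, truncKer ε (x - y) * f y ∂μ) (𝓝[>] 0) (𝓝 (h x))) ∧
      eLpNorm h 1 μ ≤ C * eLpNorm f 2 μ ∧ eLpNorm h 2 μ ≤ C * eLpNorm f ∞ μ := by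
  have hfin : IsFiniteMeasure μ := by
    rw [hμ]; exact isFiniteMeasure_withDensity (lintegral_lt_top_of_cube hR h3 hV).ne
  -- adding Lebesgue measure on the interval gives local bounds with respect to Lebesgue measure
  set I := Set.Icc (-R) R with hI
  set U : ℝ → ℝ≥0∞ := fun x => (V x : ℝ≥0∞) + I.indicator 1 x with hU
  have hUm : Measurable U := (by fun_prop : Measurable fun x => (V x : ℝ≥0∞)).add
    (measurable_one.indicator measurableSet_Icc)
  have hν : volume.withDensity U = μ + volume.restrict I := by
    rw [hU, hμ, ← withDensity_indicator_one measurableSet_Icc]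
    exact withDensity_add_left (by fun_prop) _
  have hU3 : ∫⁻ x, U x ^ 3 ≠ ∞ := by
    refine ne_top_of_le_ne_top ?_ (lintegral_mono fun x => add_pow_three_le _ _)
    rw [lintegral_const_mul' _ _ (by norm_num), lintegral_add_left (by fun_prop)]
    refine ENNReal.mul_ne_top (by norm_num) (ENNReal.add_ne_top.2 ⟨h3, ?_⟩)
    have : ∀ x, (I.indicator 1 x : ℝ≥0∞) ^ 3 = I.indicator 1 x := fun x => by
      by_cases hx : x ∈ I <;> simp [hx]
    simp_rw [this]
    rw [lintegral_indicator_one measurableSet_Icc]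
    exact isCompact_Icc.measure_lt_top.ne
  have hIfin : IsFiniteMeasure (volume.restrict I) :=
    ⟨by simpa using isCompact_Icc.measure_lt_top⟩
  have : IsFiniteMeasure (volume.withDensity U) := by rw [hν]; infer_instance
  obtain ⟨A, hA⟩ := exists_integral_poisson_sq_le hUm hU3
  set ν := volume.withDensity U
  have hμν : μ ≤ ν := by rw [hν]; exact Measure.le_add_right le_rfl
  have hσν : volume.restrict I ≤ ν := by rw [hν]; exact Measure.le_add_left le_rfl
  have hm : Measurable fun x => (V x : ℝ≥0∞) := by fun_prop
  have : IsFiniteMeasure (volume.withDensity fun x => (V x : ℝ≥0∞)) := by rwa [← hμ]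
  obtain ⟨A', hA'⟩ := exists_integral_poisson_sq_le hm h3
  rw [← hμ] at hA'
  refine ⟨ENNReal.ofReal (6 * √A' + 1), ENNReal.ofReal_ne_top, fun f hf => ?_⟩
  have hf1 : Integrable f μ := hf.integrable (by norm_num)
  have conv : ∀ φ : ℝ → ℝ, ∫ y, φ y * f y ∂μ = ∫ y, φ y * ((V y : ℝ) * f y) := by
    intro φ
    rw [hμ, integral_withDensity_eq_integral_smul hV]
    congr 1; ext y
    rw [NNReal.smul_def, smul_eq_mul]; ring
  have hg : Integrable fun y => (V y : ℝ) * f y := by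
    rw [hμ, integrable_withDensity_iff_integrable_smul hV] at hf1
    exact hf1
  have hgR : ∀ y, R < |y| → (V y : ℝ) * f y = 0 := fun y hy => by simp [hR y hy]
  have hloc : ∀ δ, 0 < δ → ∫ x in I, |∫ y, conjKer δ (x - y) * ((V y : ℝ) * f y)|
      ≤ 6 * √A * √(∫ y, f y ^ 2 ∂μ) := by
    intro δ hδ
    have := integral_abs_conj_le hμν hσν hδ (hA δ hδ) hf
    simp_rw [conv] at this
    convert this using 4
  have hex := ae_exists_tendsto_truncKer hg hgR
    (integrable_mul_log hV hR0 hR h3 (hμ ▸ hf)) (by linarith : -R ≤ R) hloc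
  have hexμ : ∀ᵐ x ∂μ, ∃ d : ℝ,
      Tendsto (fun ε => ∫ y, truncKer ε (x - y) * f y ∂μ) (𝓝[>] 0) (𝓝 d) ∧
      Tendsto (fun ε => ∫ y, conjKer ε (x - y) * f y ∂μ) (𝓝[>] 0) (𝓝 d) := by
    simp_rw [conv]
    rw [hμ, ae_withDensity_iff hm]
    filter_upwards [hex] with x hx hVx
    refine hx (abs_le.1 (not_lt.1 fun h => hVx ?_))
    simp [hR x h]
  choose! h hh using fun x (hx : ∃ d : ℝ,
      Tendsto (fun ε => ∫ y, truncKer ε (x - y) * f y ∂μ) (𝓝[>] 0) (𝓝 d) ∧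
      Tendsto (fun ε => ∫ y, conjKer ε (x - y) * f y ∂μ) (𝓝[>] 0) (𝓝 d)) => hx
  set Q : ℕ → ℝ → ℝ := fun n x => ∫ y, conjKer (1 / ((n : ℝ) + 1)) (x - y) * f y ∂μ with hQ
  have hpos : ∀ n : ℕ, 0 < 1 / ((n : ℝ) + 1) := fun n => Nat.one_div_pos_of_nat
  have hQm : ∀ n, AEStronglyMeasurable (Q n) μ := fun n =>
    aestronglyMeasurable_integral_kernel (measurable_conjKer _) hf1.1
  have hseq : Tendsto (fun n : ℕ => 1 / ((n : ℝ) + 1)) atTop (𝓝[>] 0) :=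
    tendsto_nhdsWithin_iff.2 ⟨tendsto_one_div_add_atTop_nhds_zero_nat,
      Eventually.of_forall fun n => hpos n⟩
  have hQlim : ∀ᵐ x ∂μ, Tendsto (fun n => Q n x) atTop (𝓝 (h x)) := by
    filter_upwards [hexμ] with x hx using (hh x hx).2.comp hseq
  refine ⟨h, aestronglyMeasurable_of_tendsto_ae atTop hQm hQlim, ?_, ?_, ?_⟩
  · filter_upwards [hexμ] with x hx using (hh x hx).1
  · refine (Lp.eLpNorm_lim_le_liminf_eLpNorm hQm h hQlim).trans ?_
    refine liminf_le_of_frequently_le' (Eventually.frequently (Eventually.of_forall fun n => ?_))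
    exact eLpNorm_conjKer_one_le (hpos n) (hA' _ (hpos n)) hf
  · refine (Lp.eLpNorm_lim_le_liminf_eLpNorm hQm h hQlim).trans ?_
    refine liminf_le_of_frequently_le' (Eventually.frequently (Eventually.of_forall fun n => ?_))
    exact eLpNorm_conjKer_two_le (hpos n) (hA' _ (hpos n)) hf

end

/-! ### The Hilbert transform: real or complex scalars -/

section
variable {𝕜 : Type*} [RCLike 𝕜] {μ : Measure ℝ}

lemma integrable_ofReal_truncKer_mul {f : ℝ → 𝕜} (hf : Integrable f μ) {ε : ℝ} (hε : 0 < ε)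
    (x : ℝ) : Integrable (fun y => (truncKer ε (x - y) : 𝕜) * f y) μ :=
  hf.bdd_mul (c := 1 / ε) (RCLike.continuous_ofReal.measurable.comp
    ((measurable_truncKer ε).comp (measurable_const.sub measurable_id))).aestronglyMeasurable
    (ae_of_all _ fun y => by rw [RCLike.norm_ofReal]; exact abs_truncKer_le hε _)

/-- The Hilbert transform of `f dμ`, for `μ` compactly supported with `L³` density, exists almost
everywhere as a principal value and is bounded `L² → L¹` and `L∞ → L²`. -/
theorem exists_hilbert {V : ℝ → NNReal} {R : ℝ} (hV : Measurable V) (hR0 : 0 ≤ R)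
    (hR : ∀ x, R < |x| → V x = 0)
    (h3 : ∫⁻ x, (V x : ℝ≥0∞) ^ 3 ≠ ∞) (hμ : μ = volume.withDensity fun x => (V x : ℝ≥0∞)) :
    ∃ C : ℝ≥0∞, C ≠ ∞ ∧ ∀ f : ℝ → 𝕜, MemLp f 2 μ → ∃ h : ℝ → 𝕜,
      AEStronglyMeasurable h μ ∧
      (∀ᵐ x ∂μ, Tendsto (fun ε => ∫ y, (truncKer ε (x - y) : 𝕜) * f y ∂μ) (𝓝[>] 0) (𝓝 (h x))) ∧
      eLpNorm h 1 μ ≤ C * eLpNorm f 2 μ ∧ eLpNorm h 2 μ ≤ C * eLpNorm f ∞ μ := by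
  have hfin : IsFiniteMeasure μ := by
    rw [hμ]; exact isFiniteMeasure_withDensity (lintegral_lt_top_of_cube hR h3 hV).ne
  obtain ⟨C, hC, H⟩ := exists_hilbert_real hV hR0 hR h3 hμ
  refine ⟨2 * C, ENNReal.mul_ne_top (by norm_num) hC, fun f hf => ?_⟩
  have hf1 : Integrable f μ := hf.integrable (by norm_num)
  obtain ⟨h₁, m₁, l₁, a₁, b₁⟩ := H _ hf.re
  obtain ⟨h₂, m₂, l₂, a₂, b₂⟩ := H _ hf.im
  have hre : ∀ p, eLpNorm (fun x => RCLike.re (f x)) p μ ≤ eLpNorm f p μ := fun p =>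
    eLpNorm_mono fun x => by rw [Real.norm_eq_abs]; exact RCLike.abs_re_le_norm (f x)
  have him : ∀ p, eLpNorm (fun x => RCLike.im (f x)) p μ ≤ eLpNorm f p μ := fun p =>
    eLpNorm_mono fun x => by rw [Real.norm_eq_abs]; exact RCLike.abs_im_le_norm (f x)
  have M₁ : AEStronglyMeasurable (fun x => (h₁ x : 𝕜)) μ :=
    RCLike.continuous_ofReal.comp_aestronglyMeasurable m₁
  have M₂ : AEStronglyMeasurable (fun x => (h₂ x : 𝕜) * (RCLike.I : 𝕜)) μ :=
    (RCLike.continuous_ofReal.comp_aestronglyMeasurable m₂).mul_const _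
  have hbound : ∀ p : ℝ≥0∞, 1 ≤ p → eLpNorm (fun x => (h₁ x : 𝕜) + (h₂ x : 𝕜) * RCLike.I) p μ
      ≤ eLpNorm h₁ p μ + eLpNorm h₂ p μ := by
    intro p hp
    refine (eLpNorm_add_le M₁ M₂ hp).trans ?_
    gcongr
    · exact eLpNorm_mono fun x => by simp
    · refine eLpNorm_mono fun x => ?_
      rw [norm_mul, RCLike.norm_ofReal]
      refine mul_le_of_le_one_right (abs_nonneg _) ?_
      rcases RCLike.I_mul_I_ax (K := 𝕜) with h | h
      · simp [h]
      · exact RCLike.norm_I_of_ne_zero (fun h0 => by simp [h0] at h) |>.le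
  refine ⟨fun x => (h₁ x : 𝕜) + (h₂ x : 𝕜) * RCLike.I, M₁.add M₂, ?_, ?_, ?_⟩
  · filter_upwards [l₁, l₂] with x hx₁ hx₂
    have t := ((RCLike.continuous_ofReal (K := 𝕜)).tendsto _ |>.comp hx₁).add
      (((RCLike.continuous_ofReal (K := 𝕜)).tendsto _ |>.comp hx₂).mul_const RCLike.I)
    refine t.congr' ?_
    filter_upwards [self_mem_nhdsWithin] with ε hε
    have hint := integrable_ofReal_truncKer_mul hf1 hε x
    have := integral_re_add_im hint
    rw [← this]
    simp only [Function.comp_apply, RCLike.re_ofReal_mul, RCLike.im_ofReal_mul]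
  · refine (hbound 1 le_rfl).trans ?_
    rw [mul_assoc, two_mul]
    exact add_le_add (a₁.trans (by gcongr; exact hre 2)) (a₂.trans (by gcongr; exact him 2))
  · refine (hbound 2 one_le_two).trans ?_
    rw [mul_assoc, two_mul]
    exact add_le_add (b₁.trans (by gcongr; exact hre ∞)) (b₂.trans (by gcongr; exact him ∞))

/-! ### The difference quotient transform -/

/-- Splitting the truncated difference quotient integral into two truncated Hilbert transforms, both
of which converge absolutely. -/
lemma truncDiffQuotient_eq [IsFiniteMeasure μ] {f : ℝ → 𝕜} (hf : Integrable f μ) {ε : ℝ}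
    (hε : 0 < ε) (x : ℝ) :
    truncDiffQuotient μ ε f x = f x * ∫ y, (truncKer ε (x - y) : 𝕜) * 1 ∂μ
      - ∫ y, (truncKer ε (x - y) : 𝕜) * f y ∂μ := by
  have hs : MeasurableSet {y : ℝ | ε < |x - y|} :=
    measurableSet_lt measurable_const (by fun_prop)
  rw [truncDiffQuotient, ← integral_indicator hs, ← integral_const_mul, ← integral_sub
    ((integrable_ofReal_truncKer_mul (integrable_const 1) hε x).const_mul _)
    (integrable_ofReal_truncKer_mul hf hε x)]
  congr 1; ext y
  simp only [truncKer, Set.indicator_apply, Set.mem_ofPred_eq]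
  split_ifs with h
  · rw [div_eq_mul_inv, RCLike.ofReal_inv]; ring
  · simp

namespace IsDiffQuotientOf

variable {f f' g g' : ℝ → 𝕜}

lemma congr (h : IsDiffQuotientOf μ f g) (hf : f =ᵐ[μ] f') (hg : g =ᵐ[μ] g') :
    IsDiffQuotientOf μ f' g' := by
  filter_upwards [h, hf, hg] with x hx hfx hgx
  rw [← hgx]
  refine hx.congr fun ε => ?_
  refine integral_congr_ae (ae_restrict_of_ae ?_)
  filter_upwards [hf] with y hy
  rw [hfx, hy]

lemma unique (h : IsDiffQuotientOf μ f g) (h' : IsDiffQuotientOf μ f g') : g =ᵐ[μ] g' := by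
  filter_upwards [h, h'] with x hx hx' using tendsto_nhds_unique hx hx'

lemma add [IsFiniteMeasure μ] (h : IsDiffQuotientOf μ f g) (h' : IsDiffQuotientOf μ f' g')
    (hf : Integrable f μ) (hf' : Integrable f' μ) : IsDiffQuotientOf μ (f + f') (g + g') := by
  filter_upwards [h, h'] with x hx hx'
  refine (hx.add hx').congr' ?_
  filter_upwards [self_mem_nhdsWithin] with ε hε
  have hε : 0 < ε := hε
  rw [truncDiffQuotient_eq hf hε, truncDiffQuotient_eq hf' hε, truncDiffQuotient_eq (hf.add hf') hε]
  simp only [Pi.add_apply, mul_add]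
  rw [integral_add (integrable_ofReal_truncKer_mul hf hε x)
    (integrable_ofReal_truncKer_mul hf' hε x)]
  ring

lemma const_smul (h : IsDiffQuotientOf μ f g) (c : 𝕜) : IsDiffQuotientOf μ (c • f) (c • g) := by
  filter_upwards [h] with x hx
  refine (hx.const_mul c).congr fun ε => ?_
  rw [truncDiffQuotient, truncDiffQuotient, ← integral_const_mul]
  congr 1; ext y
  simp only [Pi.smul_apply, smul_eq_mul]
  ring

end IsDiffQuotientOf

/-- A norm bound for the difference quotient transform makes it a bounded linear operator. -/
lemma exists_continuousLinearMap_of_bound [IsFiniteMeasure μ] {p q : ℝ≥0∞} [hp : Fact (1 ≤ p)]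
    [hq : Fact (1 ≤ q)] {C : ℝ≥0∞} (hC : C ≠ ∞)
    (H : ∀ f : Lp 𝕜 p μ, ∃ g : ℝ → 𝕜, AEStronglyMeasurable g μ ∧ IsDiffQuotientOf μ f g ∧
      eLpNorm g q μ ≤ C * eLpNorm f p μ) :
    ∃ T : Lp 𝕜 p μ →L[𝕜] Lp 𝕜 q μ, ∀ f : Lp 𝕜 p μ, IsDiffQuotientOf μ f (T f) := by
  choose G hGm hG hGb using H
  have hfin : ∀ f : Lp 𝕜 p μ, C * eLpNorm f p μ ≠ ∞ := fun f =>
    ENNReal.mul_ne_top hC (Lp.eLpNorm_ne_top f)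
  have hmem : ∀ f, MemLp (G f) q μ := fun f => ⟨hGm f, (hGb f).trans_lt (hfin f).lt_top⟩
  have hint : ∀ f : Lp 𝕜 p μ, Integrable f μ := fun f => (Lp.memLp f).integrable hp.out
  have hT : ∀ f : Lp 𝕜 p μ, IsDiffQuotientOf μ f ((hmem f).toLp (G f)) := fun f =>
    (hG f).congr (ae_eq_refl _) (hmem f).coeFn_toLp.symm
  let L : Lp 𝕜 p μ →ₗ[𝕜] Lp 𝕜 q μ :=
    { toFun := fun f => (hmem f).toLp (G f)
      map_add' := fun f f' => by
        refine Lp.ext ?_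
        refine (hT (f + f')).unique ?_
        exact ((hT f).add (hT f') (hint f) (hint f')).congr (Lp.coeFn_add f f').symm
          (Lp.coeFn_add _ _).symm
      map_smul' := fun c f => by
        refine Lp.ext ?_
        refine (hT (c • f)).unique ?_
        exact ((hT f).const_smul c).congr (Lp.coeFn_smul c f).symm (Lp.coeFn_smul _ _).symm }
  refine ⟨L.mkContinuous C.toReal fun f => ?_, hT⟩
  change ‖(hmem f).toLp (G f)‖ ≤ _
  rw [Lp.norm_toLp, Lp.norm_def, ← ENNReal.toReal_mul]
  exact ENNReal.toReal_mono (hfin f) (hGb f)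

/-- Over a finite measure `L²` embeds continuously into `L¹`. -/
lemma exists_inclusion_L2_L1 [IsFiniteMeasure μ] :
    ∃ J : Lp 𝕜 2 μ →L[𝕜] Lp 𝕜 1 μ, ∀ f : Lp 𝕜 2 μ, J f =ᵐ[μ] f := by
  have hmem : ∀ f : Lp 𝕜 2 μ, MemLp f 1 μ := fun f =>
    (Lp.memLp f).mono_exponent (by norm_num)
  let L : Lp 𝕜 2 μ →ₗ[𝕜] Lp 𝕜 1 μ :=
    { toFun := fun f => (hmem f).toLp f
      map_add' := fun f f' => by
        refine Lp.ext ?_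
        filter_upwards [(hmem (f + f')).coeFn_toLp, Lp.coeFn_add f f', (hmem f).coeFn_toLp,
          (hmem f').coeFn_toLp, Lp.coeFn_add ((hmem f).toLp f) ((hmem f').toLp f')]
          with x h1 h2 h3 h4 h5
        rw [h1, h2, h5, Pi.add_apply, Pi.add_apply, h3, h4]
      map_smul' := fun c f => by
        refine Lp.ext ?_
        filter_upwards [(hmem (c • f)).coeFn_toLp, Lp.coeFn_smul c f, (hmem f).coeFn_toLp,
          Lp.coeFn_smul c ((hmem f).toLp f)] with x h1 h2 h3 h5
        rw [h1, h2, RingHom.id_apply, h5, Pi.smul_apply, Pi.smul_apply, h3] }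
  refine ⟨L.mkContinuous (μ Set.univ ^ (1 / (1 : ℝ≥0∞).toReal - 1 / (2 : ℝ≥0∞).toReal)).toReal
    fun f => ?_, fun f => (hmem f).coeFn_toLp⟩
  change ‖(hmem f).toLp f‖ ≤ _
  rw [Lp.norm_toLp, Lp.norm_def, mul_comm, ← ENNReal.toReal_mul]
  refine ENNReal.toReal_mono (ENNReal.mul_ne_top (Lp.eLpNorm_ne_top f)
    (ENNReal.rpow_ne_top_of_nonneg (by norm_num) (measure_ne_top _ _))) ?_
  exact eLpNorm_le_eLpNorm_mul_rpow_measure_univ (by norm_num) (Lp.aestronglyMeasurable f)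

/-- The difference quotient transform `f ↦ f · H[μ] - H[f μ]`, where `H` is the Hilbert transform,
inherits the bounds of `exists_hilbert` by Hölder's inequality. -/
lemma exists_isDiffQuotientOf [IsFiniteMeasure μ] {C : ℝ≥0∞}
    (H : ∀ f : ℝ → 𝕜, MemLp f 2 μ → ∃ h : ℝ → 𝕜, AEStronglyMeasurable h μ ∧
      (∀ᵐ x ∂μ, Tendsto (fun ε => ∫ y, (truncKer ε (x - y) : 𝕜) * f y ∂μ) (𝓝[>] 0) (𝓝 (h x))) ∧
      eLpNorm h 1 μ ≤ C * eLpNorm f 2 μ ∧ eLpNorm h 2 μ ≤ C * eLpNorm f ∞ μ)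
    {f : ℝ → 𝕜} (hf : MemLp f 2 μ) :
    ∃ g : ℝ → 𝕜, AEStronglyMeasurable g μ ∧ IsDiffQuotientOf μ f g ∧
      eLpNorm g 1 μ ≤ 2 * C * eLpNorm f 2 μ ∧ eLpNorm g 2 μ ≤ 2 * C * eLpNorm f ∞ μ := by
  obtain ⟨h₁, m₁, l₁, -, b₁⟩ := H (fun _ => 1) (memLp_const 1)
  obtain ⟨h, m, l, a, b⟩ := H f hf
  have hone : eLpNorm h₁ 2 μ ≤ C := by
    refine b₁.trans (mul_le_of_le_one_right' ?_)
    rw [eLpNorm_exponent_top]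
    exact eLpNormEssSup_le_of_ae_enorm_bound (ae_of_all _ fun _ => by simp)
  refine ⟨fun x => f x * h₁ x - h x, (hf.1.mul m₁).sub m, ?_, ?_, ?_⟩
  · filter_upwards [l₁, l] with x hx₁ hx
    refine ((hx₁.const_mul (f x)).sub hx).congr' ?_
    filter_upwards [self_mem_nhdsWithin] with ε hε
    rw [truncDiffQuotient_eq (hf.integrable (by norm_num)) hε]
  · refine (eLpNorm_sub_le (hf.1.mul m₁) m le_rfl).trans ?_
    rw [two_mul, add_mul]
    gcongr
    calc _ ≤ eLpNorm f 2 μ * eLpNorm h₁ 2 μ := eLpNorm_smul_le_mul_eLpNorm (r := 1) m₁ hf.1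
      _ ≤ _ := by rw [mul_comm]; gcongr
  · refine (eLpNorm_sub_le (hf.1.mul m₁) m one_le_two).trans ?_
    rw [two_mul, add_mul]
    gcongr
    calc _ ≤ eLpNorm f ∞ μ * eLpNorm h₁ 2 μ := eLpNorm_smul_le_mul_eLpNorm (r := 2) m₁ hf.1
      _ ≤ _ := by rw [mul_comm]; gcongr

/-- A compactly supported measure with `L³` density has a density that is measurable, finite, and
vanishes identically outside an interval. -/
lemma exists_density {w : ℝ → ℝ} (hw : MemLp w 3 volume)
    (hμ : μ = volume.withDensity (fun x => ENNReal.ofReal (w x))) (hsupp : IsCompact μ.support) :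
    ∃ (V : ℝ → NNReal) (R : ℝ), Measurable V ∧ 0 ≤ R ∧ (∀ x, R < |x| → V x = 0) ∧
      ∫⁻ x, (V x : ℝ≥0∞) ^ 3 ≠ ∞ ∧ μ = volume.withDensity fun x => (V x : ℝ≥0∞) := by
  obtain ⟨R, hR0, hR⟩ := hsupp.isBounded.exists_pos_norm_le
  set w' := hw.1.mk w
  have hw'm : Measurable w' := hw.1.measurable_mk
  have hww' : w =ᵐ[volume] w' := hw.1.ae_eq_mk
  refine ⟨(Set.Icc (-R) R).indicator fun x => (w' x).toNNReal, R,
    hw'm.real_toNNReal.indicator measurableSet_Icc, hR0.le, fun x hx => ?_, ?_, ?_⟩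
  · have : x ∉ Set.Icc (-R) R := fun h => hx.not_ge (abs_le.2 h)
    rw [Set.indicator_of_notMem this]
  · have h3 := lintegral_rpow_enorm_lt_top_of_eLpNorm_lt_top (by norm_num) (by norm_num) hw.2
    refine ne_top_of_le_ne_top h3.ne (lintegral_mono_ae ?_)
    filter_upwards [hww'] with x hx
    have h : (((Set.Icc (-R) R).indicator (fun x => (w' x).toNNReal) x : NNReal) : ℝ≥0∞)
        ≤ ‖w x‖ₑ := by
      by_cases hxI : x ∈ Set.Icc (-R) R
      · rw [Set.indicator_of_mem hxI, hx, Real.enorm_eq_ofReal_abs]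
        exact ENNReal.ofReal_le_ofReal (le_abs_self _)
      · rw [Set.indicator_of_notMem hxI]; simp
    have e : ((3 : ℝ≥0∞).toReal) = ((3 : ℕ) : ℝ) := by norm_num
    rw [e, ENNReal.rpow_natCast]
    gcongr
  · have hzero : ∀ᵐ x, x ∈ μ.supportᶜ → ENNReal.ofReal (w x) = 0 := by
      have hms : MeasurableSet μ.supportᶜ := Measure.isOpen_compl_support.measurableSet
      have h0 : μ μ.supportᶜ = 0 := Measure.measure_compl_support
      have h1 : ∫⁻ x in μ.supportᶜ, ENNReal.ofReal (w x) = 0 := by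
        rw [← withDensity_apply _ hms, ← hμ, h0]
      rw [lintegral_eq_zero_iff' (hw.1.aemeasurable.ennreal_ofReal.restrict)] at h1
      exact (ae_restrict_iff' hms).1 h1
    rw [hμ]
    refine withDensity_congr_ae ?_
    filter_upwards [hzero, hww'] with x hx hwx
    by_cases hxI : x ∈ Set.Icc (-R) R
    · rw [Set.indicator_of_mem hxI, hwx]; rfl
    · rw [Set.indicator_of_notMem hxI]
      exact hx fun hxs => hxI (abs_le.1 (hR x hxs))

end

/-! ### The operators on `L²` and `L∞` -/

theorem mainTheorem7 {𝕜 : Type*} [RCLike 𝕜] (μ : Measure ℝ) (w : ℝ → ℝ)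
    (hw_nonneg : 0 ≤ᵐ[volume] w) (hw : MemLp w 3 volume)
    (hμ : μ = volume.withDensity (fun x => ENNReal.ofReal (w x)))
    (hsupp : IsCompact μ.support) :
    (∃ T : Lp 𝕜 2 μ →L[𝕜] Lp 𝕜 1 μ, ∀ f : Lp 𝕜 2 μ, IsDiffQuotientOf μ f (T f)) ∧
    (∃ T : Lp 𝕜 ∞ μ →L[𝕜] Lp 𝕜 2 μ, ∀ f : Lp 𝕜 ∞ μ, IsDiffQuotientOf μ f (T f)) ∧
    (∃ D : Lp 𝕜 2 μ →ₗ.[𝕜] Lp 𝕜 2 μ,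
      (∀ f g : Lp 𝕜 2 μ, (f, g) ∈ D.graph ↔ IsDiffQuotientOf μ f g) ∧
      Dense (D.domain : Set (Lp 𝕜 2 μ)) ∧ D.IsClosed) := by
  obtain ⟨V, R, hV, hR0, hR, h3, hμV⟩ := exists_density hw hμ hsupp
  have hfin : IsFiniteMeasure μ := by
    rw [hμV]; exact isFiniteMeasure_withDensity (lintegral_lt_top_of_cube hR h3 hV).ne
  obtain ⟨C, hC, H⟩ := exists_hilbert (𝕜 := 𝕜) hV hR0 hR h3 hμV
  have hC2 : 2 * C ≠ ∞ := ENNReal.mul_ne_top (by norm_num) hC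
  obtain ⟨T₁, hT₁⟩ := exists_continuousLinearMap_of_bound (p := 2) (q := 1) (μ := μ) hC2
    fun f : Lp 𝕜 2 μ => by
      obtain ⟨g, hm, hg, h1, -⟩ := exists_isDiffQuotientOf H (Lp.memLp f)
      exact ⟨g, hm, hg, h1⟩
  obtain ⟨T₂, hT₂⟩ := exists_continuousLinearMap_of_bound (p := ∞) (q := 2) (μ := μ) hC2
    fun f : Lp 𝕜 ∞ μ => by
      obtain ⟨g, hm, hg, -, h2⟩ := exists_isDiffQuotientOf H ((Lp.memLp f).mono_exponent le_top)
      exact ⟨g, hm, hg, h2⟩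
  obtain ⟨J, hJ⟩ := exists_inclusion_L2_L1 (𝕜 := 𝕜) (μ := μ)
  -- the graph is the kernel of the continuous map `(f, g) ↦ T₁ f - J g` into `L¹`
  let S : Lp 𝕜 2 μ × Lp 𝕜 2 μ →L[𝕜] Lp 𝕜 1 μ :=
    T₁.comp (ContinuousLinearMap.fst 𝕜 _ _) - J.comp (ContinuousLinearMap.snd 𝕜 _ _)
  have hS : ∀ f g : Lp 𝕜 2 μ, (f, g) ∈ LinearMap.ker S.toLinearMap ↔ IsDiffQuotientOf μ f g := by
    intro f g
    have e : (f, g) ∈ LinearMap.ker S.toLinearMap ↔ T₁ f = J g := by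
      simp [S, sub_eq_zero]
    rw [e]
    refine ⟨fun h => (hT₁ f).congr (ae_eq_refl _) (h ▸ hJ g), fun h => Lp.ext ?_⟩
    exact ((hT₁ f).unique h).trans (hJ g).symm
  have hgraph : (LinearMap.ker S.toLinearMap).toLinearPMap.graph = LinearMap.ker S.toLinearMap := by
    refine Submodule.toLinearPMap_graph_eq _ ?_
    rintro ⟨f, g⟩ hfg (rfl : f = 0)
    have h0 : ((0 : Lp 𝕜 2 μ), (0 : Lp 𝕜 2 μ)) ∈ LinearMap.ker S.toLinearMap := Submodule.zero_mem _
    exact Lp.ext (((hS _ _).1 hfg).unique ((hS _ _).1 h0))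
  refine ⟨⟨T₁, hT₁⟩, ⟨T₂, hT₂⟩, (LinearMap.ker S.toLinearMap).toLinearPMap,
    fun f g => by rw [hgraph]; exact hS f g, ?_, ?_⟩
  · -- simple functions are bounded, hence belong to the domain
    refine (Lp.simpleFunc.dense (E := 𝕜) (μ := μ) (p := 2) (by norm_num)).mono ?_
    rintro f ⟨s, hs⟩
    have hsm : MemLp s ∞ μ := s.memLp_top μ
    have hfs : (f : ℝ → 𝕜) =ᵐ[μ] s := by
      have h0 := AEEqFun.coeFn_mk (μ := μ) s s.aestronglyMeasurable
      rw [hs] at h0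
      exact h0
    have hmem : (f, T₂ (hsm.toLp s)) ∈ (LinearMap.ker S.toLinearMap).toLinearPMap.graph := by
      rw [hgraph, hS]
      exact (hT₂ (hsm.toLp s)).congr (hsm.coeFn_toLp.trans hfs.symm) (ae_eq_refl _)
    exact LinearPMap.mem_domain_of_mem_graph hmem
  · rw [LinearPMap.IsClosed, hgraph]
    exact S.isClosed_ker
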